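/- Work over $\mathbf C$. Let $\mathcal H=(\mathbf P^1)^6$ be the space of labelled sextuples $h=(A,B,C,D,E,F)$ of points of $\mathbf P^1$, where $\mathbf P^1$ is identified with the conic $z_0z_2=z_1^2$ in $\mathbf P^2$ by $\tau(t)=[1,t,t^2]$, $\tau(\infty)=[0,0,1]$. Let $$p_s:\mathcal H\dashrightarrow(\mathbf P^2)^*$$ be the rational map sending a general sextuple to its Pascal line for the array $s=\begin{bmatrix}A&B&C\\F&E&D\end{bmatrix}$, i.e. the line through the points $AE\cap BF$, $AD\cap CF$ and $BD\cap CE$. Let $\Omega_s\subseteq\mathcal H$ be its indeterminacy scheme (scheme of base points): near each point it is defined by the ideal generated by the homogeneous coordinates of $p_s$, chosen to be regular functions without common factor. For a partition $\pi$ of the set of letters $\{A,\dots,F\}$ let $\Delta_\pi\subseteq\mathcal H$ be the polydiagonal, the closed subscheme of those $h$ with $h(x)=h(y)$ whenever $x,y$ lie in the same block of $\pi$. On the affine chart $\operatorname{Spec} R\subset\mathcal H$, $R=\mathbf C[a,b,c,d,e,f]$, on which $A=\tau(a),\dots,F=\tau(f)$, the map $p_s$ is given by $\langle u_0,u_1,u_2\rangle$,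 where $$\begin{aligned}u_0&=abde-abdf-acde+acef+bcdf-bcef,\\ u_1&=-abe+abf+acd-acf+adf-aef-bcd+bce-bde+bef+cde-cdf,\\ u_2&=-ad+ae+bd-bf-ce+cf,\end{aligned}$$ and $\Omega_s\cap\operatorname{Spec}R$ is defined by the ideal $(u_0,u_1,u_2)$. This ideal is the irredundant intersection of the six prime ideals $$\mathfrak p_1=(b-c,a-c),\quad \mathfrak p_2=(e-f,d-f),\quad \mathfrak p_3=(e-f,a-b),$$ $$\mathfrak p_4=(d-e,b-c),\quad \mathfrak p_5=(d-f,a-c),\quad \mathfrak p_6=(c-d,b-e,a-f).$$ Globally, $\Omega_s$ is the scheme-theoretic union of the six polydiagonals $\Delta_{\vartheta_1},\dots,\Delta_{\vartheta_6}$ (its ideal sheaf is the intersection of theirs), where $$\vartheta_1=ABC.D.E.F,\quad \vartheta_2=A.B.C.DEF,\quad \vartheta_3=AB.C.D.EF,$$ $$\vartheta_4=A.BC.DE.F,\quad \vartheta_5=AC.B.DF.E,\quad \vartheta_6=AF.BE.CD.$$ The first two are of type $(3,1,1,1)$, the next three of type $(2,2,1,1)$ and the last of type $(2,2,2)$. Each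 $\Delta_{\vartheta_i}$ is an integral scheme, $\Omega_s$ is reduced, and it has exactly six irreducible components, namely $\Delta_{\vartheta_1},\dots,\Delta_{\vartheta_6}$. -/

import Mathlib

open CategoryTheory AlgebraicGeometry

namespace Pascal

/-- The six letters labelling a sextuple of points. -/
inductive Letter | A | B | C | D | E | F
  deriving DecidableEq

instance : Fintype Letter :=
  ⟨{.A, .B, .C, .D, .E, .F}, by intro x; cases x <;> decide⟩

noncomputable section

open Limits MvPolynomial

/-- The standard grading of `ℂ[X₀, X₁]`. -/
abbrev grading : ℕ → Submodule ℂ (MvPolynomial (Fin 2) ℂ) := homogeneousSubmodule (Fin 2) ℂ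

instance : GradedRing grading := MvPolynomial.gradedAlgebra

lemma X_mem (i : Fin 2) : (X i : MvPolynomial (Fin 2) ℂ) ∈ grading 1 := isHomogeneous_X ℂ i

/-- The complex projective line. -/
abbrev P1 : Scheme.{0} := Proj grading

/-- The structure morphism of the projective line. -/
def P1.str : P1 ⟶ Spec (.of ℂ) :=
  Proj.toSpecZero grading ≫ Spec.map (CommRingCat.ofHom (algebraMap ℂ (grading 0)))

/-- The space of labelled sextuples of points, i.e. the sixfold fibre power of the projective line
over `Spec ℂ`. -/
def Sextuple : Scheme.{0} :=
  widePullback (Spec (.of ℂ)) (fun _ : Letter => P1) (fun _ => P1.str)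

/-- The structure morphism of the space of sextuples. -/
def Sextuple.str : Sextuple ⟶ Spec (.of ℂ) := WidePullback.base (fun _ : Letter => P1.str)

/-- The projection sending a sextuple `h` to its point `h x`. -/
def pr (x : Letter) : Sextuple ⟶ P1 := WidePullback.π (fun _ : Letter => P1.str) x

lemma pr_str (x : Letter) : pr x ≫ P1.str = Sextuple.str := WidePullback.π_arrow _ x

lemma Sextuple.hom_ext {Z : Scheme.{0}} {g h : Z ⟶ Sextuple}
    (hs : g ≫ Sextuple.str = h ≫ Sextuple.str) (hp : ∀ x, g ≫ pr x = h ≫ pr x) : g = h :=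
  WidePullback.hom_ext _ _ _ hp hs

/-- The coordinate ring of the standard affine chart `D₊(Xᵢ)` of the projective line. -/
abbrev Away (i : Fin 2) := HomogeneousLocalization.Away grading (X i : MvPolynomial (Fin 2) ℂ)

/-- The `ℂ`-algebra map out of the coordinate ring of `D₊(Xᵢ)` that sends the affine coordinate
`X₁₋ᵢ / Xᵢ` to `t`. -/
def dehomog (i : Fin 2) {B : Type} [CommRing B] [Algebra ℂ B] (t : B) : Away i →+* B :=
  (IsLocalization.Away.lift (S := Localization.Away (X i : MvPolynomial (Fin 2) ℂ)) (X i)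
    (g := (aeval (fun k => if k = i then 1 else t) : MvPolynomial (Fin 2) ℂ →ₐ[ℂ] B).toRingHom)
    (by simp)).comp (algebraMap (Away i) (Localization.Away (X i : MvPolynomial (Fin 2) ℂ)))

lemma eval₂_smul_of_isHomogeneous {B : Type*} [CommRing B] (f : ℂ →+* B) (u : B) (g : Fin 2 → B)
    {n : ℕ} {a : MvPolynomial (Fin 2) ℂ} (ha : a.IsHomogeneous n) :
    eval₂ f (fun k => u * g k) a = u ^ n * eval₂ f g a := by
  rw [eval₂_eq', eval₂_eq', Finset.mul_sum]
  refine Finset.sum_congr rfl fun d hd => ?_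
  have h : d 0 + d 1 = n := by
    have := ha (mem_support_iff.mp hd)
    simpa [Finsupp.weight_apply, Finsupp.sum_fintype] using this
  simp only [Fin.prod_univ_two, mul_pow, ← h, pow_add]
  ring

/-- The scalars in the coordinate ring of `D₊(Xᵢ)`. -/
def Away.const (i : Fin 2) : ℂ →+* Away i :=
  (HomogeneousLocalization.fromZeroRingHom grading _).comp (algebraMap ℂ (grading 0))

/-- The function `Xₖ / Xᵢ` on `D₊(Xᵢ)`. -/
def Away.ratio (i k : Fin 2) : Away i :=
  HomogeneousLocalization.Away.mk grading (X_mem i) 1 (X k)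
    (by simpa using X_mem k)

lemma Away.mk_eq (i : Fin 2) (n : ℕ) (a : MvPolynomial (Fin 2) ℂ) (ha : a ∈ grading (n • 1)) :
    HomogeneousLocalization.Away.mk grading (X_mem i) n a ha =
      eval₂ (Away.const i) (Away.ratio i) a := by
  apply HomogeneousLocalization.val_injective
  rw [HomogeneousLocalization.Away.val_mk, ← HomogeneousLocalization.algebraMap_apply, hom_eval₂]
  have ha' : a.IsHomogeneous n := by simpa using ha
  let L := Localization.Away (X i : MvPolynomial (Fin 2) ℂ)
  let u : L := Localization.mk 1 ⟨X i, 1, by simp⟩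
  let α : MvPolynomial (Fin 2) ℂ →+* L := algebraMap _ _
  have h1 : (fun k => algebraMap (Away i) L (Away.ratio i k)) = fun k => u * α (X k) := by
    funext k
    rw [HomogeneousLocalization.algebraMap_apply, Away.ratio,
      HomogeneousLocalization.Away.val_mk]
    simp only [α, u]
    rw [← Localization.mk_one_eq_algebraMap, Localization.mk_mul]
    simp
  have h2 : (algebraMap (Away i) L).comp (Away.const i) = α.comp C := by
    ext c
    simp only [RingHom.comp_apply, Away.const]
    exact Localization.mk_one_eq_algebraMap _
  have h3 := eval₂_smul_of_isHomogeneous (α.comp C) u (fun k => α (X k)) ha'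
  have h4 : α a = eval₂ (α.comp C) (fun k => α (X k)) a := by
    conv_lhs => rw [← eval₂_eta a]
    rw [hom_eval₂]
  change _ = eval₂ ((algebraMap (Away i) L).comp (Away.const i))
    (fun k => algebraMap (Away i) L (Away.ratio i k)) a
  rw [h2, h1, h3, ← h4]
  simp only [α, u]
  rw [Localization.mk_pow, ← Localization.mk_one_eq_algebraMap, Localization.mk_mul, one_pow, one_mul, mul_one]
  rfl

lemma Away.hom_ext {i : Fin 2} {B : Type*} [CommRing B] {φ ψ : Away i →+* B}
    (hc : φ.comp (Away.const i) = ψ.comp (Away.const i))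
    (ht : ∀ k, φ (Away.ratio i k) = ψ (Away.ratio i k)) : φ = ψ := by
  ext z
  obtain ⟨n, a, ha, rfl⟩ := HomogeneousLocalization.Away.mk_surjective grading (X_mem i) z
  rw [Away.mk_eq, hom_eval₂, hom_eval₂, hc]
  congr 1
  exact funext ht

@[simp] lemma Away.ratio_self (i : Fin 2) : Away.ratio i i = 1 := by
  apply HomogeneousLocalization.val_injective
  rw [Away.ratio, HomogeneousLocalization.Away.val_mk, HomogeneousLocalization.val_one,
    ← Localization.mk_one, Localization.mk_eq_mk_iff, Localization.r_iff_exists]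
  exact ⟨1, by simp⟩

lemma dehomog_const (i : Fin 2) {B : Type} [CommRing B] [Algebra ℂ B] (t : B) :
    (dehomog i t).comp (Away.const i) = algebraMap ℂ B := by
  ext c
  have : algebraMap (Away i) (Localization.Away (X i : MvPolynomial (Fin 2) ℂ)) (Away.const i c)
    = algebraMap (MvPolynomial (Fin 2) ℂ) _ (C c) := by
    simp only [Away.const, HomogeneousLocalization.algebraMap_apply]
    exact Localization.mk_one_eq_algebraMap _
  simp only [RingHom.comp_apply, dehomog, this, IsLocalization.Away.lift_eq]
  simp

lemma dehomog_ratio (i k : Fin 2) {B : Type} [CommRing B] [Algebra ℂ B] (t : B) :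
    dehomog i t (Away.ratio i k) = if k = i then 1 else t := by
  have h : algebraMap (Away i) (Localization.Away (X i : MvPolynomial (Fin 2) ℂ)) (Away.ratio i k) *
      algebraMap (MvPolynomial (Fin 2) ℂ) _ (X i) =
        algebraMap (MvPolynomial (Fin 2) ℂ) _ (X k) := by
    rw [HomogeneousLocalization.algebraMap_apply, Away.ratio,
      HomogeneousLocalization.Away.val_mk, ← Localization.mk_one_eq_algebraMap,
      ← Localization.mk_one_eq_algebraMap, Localization.mk_mul, Localization.mk_eq_mk_iff,
      Localization.r_iff_exists]
    exact ⟨1, by simp; ring⟩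
  have h' := congrArg (IsLocalization.Away.lift (S := Localization.Away (X i : MvPolynomial (Fin 2) ℂ)) (X i)
    (g := (aeval (fun k => if k = i then 1 else t) : MvPolynomial (Fin 2) ℂ →ₐ[ℂ] B).toRingHom)
    (by simp)) h
  rw [map_mul, IsLocalization.Away.lift_eq, IsLocalization.Away.lift_eq] at h'
  simpa [dehomog] using h'


/-- The inclusion of the standard affine chart of the projective line. -/
abbrev P1.chart (i : Fin 2) : Spec (.of (Away i)) ⟶ P1 :=
  Proj.awayι grading (X i) (X_mem i) one_pos

instance (i : Fin 2) : IsOpenImmersion (P1.chart i) :=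
  inferInstanceAs (IsOpenImmersion (Proj.awayι grading (X i) (X_mem i) one_pos))

/-- The standard affine open subset `D₊(Xᵢ)` of the projective line. -/
abbrev P1.std (i : Fin 2) : P1.Opens := Proj.basicOpen grading (X i)

lemma P1.opensRange_chart (i : Fin 2) : (P1.chart i).opensRange = P1.std i :=
  Proj.opensRange_awayι grading (X i) (X_mem i) one_pos

lemma P1.chart_str (i : Fin 2) :
    P1.chart i ≫ P1.str = Spec.map (CommRingCat.ofHom (Away.const i)) := by
  have := Proj.awayι_toSpecZero grading (X i) (X_mem i) one_pos
  rw [P1.chart, P1.str]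
  erw [← Category.assoc, this, ← Spec.map_comp]
  rfl

/-- The ring map corresponding to a morphism into an affine scheme. -/
def sharp {Z : Scheme.{0}} {A : Type} [CommRing A] (f : Z ⟶ Spec (.of A)) : A →+* Γ(Z, ⊤) :=
  ((Scheme.ΓSpecIso (.of A)).inv ≫ f.appTop).hom

lemma sharp_comp {Z : Scheme.{0}} {A B : Type} [CommRing A] [CommRing B] (f : Z ⟶ Spec (.of B))
    (φ : A →+* B) : sharp (f ≫ Spec.map (CommRingCat.ofHom φ)) = (sharp f).comp φ := by
  have := Scheme.ΓSpecIso_inv_naturality (CommRingCat.ofHom φ)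
  simp only [sharp, Scheme.Hom.comp_appTop, ← reassoc_of% this]
  rfl

lemma hom_ext_sharp {Z : Scheme.{0}} {A : Type} [CommRing A] {f g : Z ⟶ Spec (.of A)}
    (h : sharp f = sharp g) : f = g :=
  ext_to_Spec (CommRingCat.hom_ext h)

lemma exists_sharp_eq {Z : Scheme.{0}} {A : Type} [CommRing A] (φ : A →+* Γ(Z, ⊤)) :
    ∃ f : Z ⟶ Spec (.of A), sharp f = φ := by
  refine ⟨Z.toSpecΓ ≫ Spec.map (CommRingCat.ofHom φ), ?_⟩
  have h : sharp (A := Γ(Z, ⊤)) Z.toSpecΓ = RingHom.id _ := by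
    have h' : (Scheme.ΓSpecIso Γ(Z, ⊤)).inv ≫ Z.toSpecΓ.appTop = 𝟙 _ := by simp
    exact congrArg CommRingCat.Hom.hom h'
  exact (sharp_comp Z.toSpecΓ φ).trans (by rw [h]; rfl)

/-- The polynomial ring `ℂ[a, b, c, d, e, f]`. -/
abbrev R : Type := MvPolynomial Letter ℂ

/-- The standard affine charts of the space of sextuples. Where `T x = 0` the point labelled `x` is
`[1 : t]` with `t` the variable `x`, and where `T x = 1` it is `[t : 1]`. -/
def chart (T : Letter → Fin 2) : Spec (.of R) ⟶ Sextuple :=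
  WidePullback.lift (Spec.map (CommRingCat.ofHom (algebraMap ℂ R)))
    (fun x => Spec.map (CommRingCat.ofHom (dehomog (T x) (X x : R))) ≫ P1.chart (T x)) (by
      intro x
      rw [Category.assoc, P1.chart_str, ← Spec.map_comp, ← CommRingCat.ofHom_comp, dehomog_const])

lemma chart_pr (T : Letter → Fin 2) (x : Letter) : chart T ≫ pr x =
    Spec.map (CommRingCat.ofHom (dehomog (T x) (X x : R))) ≫ P1.chart (T x) :=
  WidePullback.lift_π ..

lemma chart_str (T : Letter → Fin 2) : chart T ≫ Sextuple.str =
    Spec.map (CommRingCat.ofHom (algebraMap ℂ R)) :=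
  WidePullback.lift_base ..

/-- The open subset covered by a standard affine chart. -/
def stdOpen (T : Letter → Fin 2) : Sextuple.Opens := ⨅ x, pr x ⁻¹ᵁ P1.std (T x)

instance (T : Letter → Fin 2) : Mono (chart T) where
  right_cancellation {Z} g h e := by
    have hx : ∀ x, g ≫ Spec.map (CommRingCat.ofHom (dehomog (T x) (X x : R))) =
        h ≫ Spec.map (CommRingCat.ofHom (dehomog (T x) (X x : R))) := by
      intro x
      have := congrArg (· ≫ pr x) e
      simp only [Category.assoc, chart_pr] at this
      rwa [← Category.assoc, ← Category.assoc, cancel_mono] at this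
    have hb : g ≫ Spec.map (CommRingCat.ofHom (algebraMap ℂ R)) =
        h ≫ Spec.map (CommRingCat.ofHom (algebraMap ℂ R)) := by
      have := congrArg (· ≫ Sextuple.str) e
      simpa only [Category.assoc, chart_str] using this
    apply hom_ext_sharp
    apply MvPolynomial.ringHom_ext
    · intro c
      have := congrArg sharp hb
      rw [sharp_comp, sharp_comp] at this
      exact RingHom.congr_fun this c
    · intro x
      have := congrArg sharp (hx x)
      rw [sharp_comp, sharp_comp] at this
      have := RingHom.congr_fun this (Away.ratio (T x) (T x + 1))
      simp only [RingHom.comp_apply, dehomog_ratio] at this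
      simpa using this



lemma mem_stdOpen (T : Letter → Fin 2) (p : Sextuple) :
    p ∈ stdOpen T ↔ ∀ x, pr x p ∈ P1.std (T x) := by
  rw [stdOpen, ← SetLike.mem_coe, TopologicalSpace.Opens.coe_iInf, Set.mem_iInter]
  rfl

lemma range_chart_subset (T : Letter → Fin 2) :
    Set.range (chart T) ⊆ Set.range (stdOpen T).ι := by
  rintro _ ⟨p, rfl⟩
  rw [Scheme.Opens.range_ι]
  refine (mem_stdOpen T _).2 fun x => ?_
  rw [← Scheme.Hom.comp_apply, chart_pr, Scheme.Hom.comp_apply, ← P1.opensRange_chart]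
  exact ⟨_, rfl⟩

lemma exists_section_chart (T : Letter → Fin 2) :
    ∃ g : (stdOpen T).toScheme ⟶ Spec (.of R), g ≫ chart T = (stdOpen T).ι := by
  have hl : ∀ x, ∃ l : (stdOpen T).toScheme ⟶ Spec (.of (Away (T x))),
      l ≫ P1.chart (T x) = (stdOpen T).ι ≫ pr x := by
    intro x
    refine ⟨IsOpenImmersion.lift (P1.chart (T x)) ((stdOpen T).ι ≫ pr x) ?_,
      IsOpenImmersion.lift_fac _ _ _⟩
    rintro _ ⟨p, rfl⟩
    have := (mem_stdOpen T p.1).1 p.2 x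
    rw [← P1.opensRange_chart] at this
    exact this
  choose l hl using hl
  let b : (stdOpen T).toScheme ⟶ Spec (.of ℂ) := (stdOpen T).ι ≫ Sextuple.str
  have hlb : ∀ x, (sharp (l x)).comp (Away.const (T x)) = sharp b := by
    intro x
    rw [← sharp_comp, ← P1.chart_str, reassoc_of% hl, pr_str]
  obtain ⟨g, hg⟩ := exists_sharp_eq (Z := (stdOpen T).toScheme) (A := R)
    (eval₂Hom (sharp b) fun x => sharp (l x) (Away.ratio (T x) (T x + 1)))
  have hgb : (sharp g).comp (algebraMap ℂ R) = sharp b := by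
    rw [hg]; ext c; simp [MvPolynomial.algebraMap_eq]
  refine ⟨g, Sextuple.hom_ext ?_ fun x => ?_⟩
  · rw [Category.assoc, chart_str]
    exact hom_ext_sharp (by rw [sharp_comp, hgb])
  · rw [Category.assoc, chart_pr, ← Category.assoc, ← hl]
    congr 1
    apply hom_ext_sharp
    rw [sharp_comp]
    apply Away.hom_ext
    · rw [RingHom.comp_assoc, dehomog_const, hgb, hlb]
    · intro k
      rw [RingHom.comp_apply, dehomog_ratio]
      split_ifs with h
      · subst h; simp
      · obtain rfl : k = T x + 1 := by
          generalize T x = i at h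
          revert i k; decide
        simp [hg]

instance (T : Letter → Fin 2) : IsOpenImmersion (chart T) := by
  obtain ⟨g, hg⟩ := exists_section_chart T
  let f := IsOpenImmersion.lift (stdOpen T).ι (chart T) (range_chart_subset T)
  have hf : f ≫ (stdOpen T).ι = chart T := IsOpenImmersion.lift_fac _ _ _
  have h1 : f ≫ g = 𝟙 _ := by rw [← cancel_mono (chart T), Category.assoc, hg, hf]; simp
  have h2 : g ≫ f = 𝟙 _ := by rw [← cancel_mono (stdOpen T).ι, Category.assoc, hf, hg]; simp
  have : IsIso f := ⟨g, h1, h2⟩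
  rw [← hf]
  infer_instance

lemma opensRange_chart (T : Letter → Fin 2) : (chart T).opensRange = stdOpen T := by
  obtain ⟨g, hg⟩ := exists_section_chart T
  apply le_antisymm
  · intro p hp
    have := range_chart_subset T hp
    rwa [Scheme.Opens.range_ι] at this
  · intro p hp
    refine ⟨g ⟨p, hp⟩, ?_⟩
    exact (Scheme.Hom.comp_apply g (chart T) _).symm.trans (by rw [hg]; rfl)

lemma P1.exists_mem_std (p : P1) : ∃ i, p ∈ P1.std i := by
  have h := Proj.iSup_basicOpen_eq_top' grading (fun i : Fin 2 => (X i : MvPolynomial (Fin 2) ℂ))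
    (fun i => ⟨1, X_mem i⟩) (by
      refine top_le_iff.1 fun q _ => ?_
      induction q using MvPolynomial.induction_on with
      | C a =>
        exact Subalgebra.algebraMap_mem _ (⟨C a, isHomogeneous_C _ a⟩ : grading 0)
      | add p q hp hq => exact add_mem (hp trivial) (hq trivial)
      | mul_X p i hp => exact mul_mem (hp trivial) (Algebra.subset_adjoin ⟨i, rfl⟩))
  have hp : p ∈ ⨆ i : Fin 2, Proj.basicOpen grading (X i) := h ▸ TopologicalSpace.Opens.mem_top _
  exact TopologicalSpace.Opens.mem_iSup.1 hp

lemma exists_mem_stdOpen (p : Sextuple) : ∃ T, p ∈ stdOpen T := by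
  choose T hT using fun x => P1.exists_mem_std (pr x p)
  exact ⟨T, (mem_stdOpen T p).2 hT⟩

lemma P1.chart_preimage_std (i j : Fin 2) : P1.chart i ⁻¹ᵁ P1.std j = PrimeSpectrum.basicOpen
    (HomogeneousLocalization.Away.isLocalizationElem (X_mem i) (X_mem j)) :=
  Proj.awayι_preimage_basicOpen grading (X_mem i) one_pos (X_mem j) one_pos

/-- A closed point of the chart all of whose coordinates are `1`. -/
def unitPoint : Spec (.of R) :=
  Spec.map (CommRingCat.ofHom (aeval (fun _ => (1 : ℂ)) : R →ₐ[ℂ] ℂ).toRingHom) (⊥ : PrimeSpectrum ℂ)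

lemma chart_unitPoint_mem (T S : Letter → Fin 2) : chart T unitPoint ∈ stdOpen S := by
  refine (mem_stdOpen _ _).2 fun x => ?_
  rw [← Scheme.Hom.comp_apply, chart_pr, Scheme.Hom.comp_apply]
  suffices Spec.map (CommRingCat.ofHom (dehomog (T x) (X x : R))) unitPoint ∈
      P1.chart (T x) ⁻¹ᵁ P1.std (S x) from this
  rw [P1.chart_preimage_std]
  change (aeval (fun _ => (1 : ℂ)) : R →ₐ[ℂ] ℂ) (dehomog (T x) (X x : R) _) ∉ (⊥ : Ideal ℂ)
  rw [HomogeneousLocalization.Away.isLocalizationElem, Away.mk_eq, pow_one, eval₂_X, dehomog_ratio]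
  split_ifs <;> simp

lemma isIrreducible_stdOpen (T : Letter → Fin 2) : IsIrreducible (stdOpen T : Set Sextuple) := by
  rw [← opensRange_chart]
  have := (IrreducibleSpace.isIrreducible_univ (Spec (.of R))).image (chart T)
    (chart T).continuous.continuousOn
  rwa [Set.image_univ] at this

instance : IrreducibleSpace Sextuple := by
  rw [irreducibleSpace_def]
  have h : closure (stdOpen 0 : Set Sextuple) = Set.univ := by
    refine Set.eq_univ_of_forall fun p => ?_
    obtain ⟨T, hT⟩ := exists_mem_stdOpen p
    refine closure_mono Set.inter_subset_right (subset_closure_inter_of_isPreirreducible_of_isOpen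
      (isIrreducible_stdOpen T).2 (stdOpen 0).isOpen ⟨_, chart_unitPoint_mem T T,
        chart_unitPoint_mem T 0⟩ hT)
  have := (isIrreducible_stdOpen 0).closure
  rwa [h] at this

instance : IsReduced Sextuple := by
  have (T : Letter → Fin 2) : IsReduced (stdOpen T).toScheme := by
    obtain ⟨g, hg⟩ := exists_section_chart T
    have : IsOpenImmersion (g ≫ chart T) := hg ▸ inferInstance
    have := IsOpenImmersion.of_comp g (chart T)
    exact isReduced_of_isOpenImmersion g
  have hc : TopologicalSpace.IsOpenCover stdOpen := by
    refine top_le_iff.1 fun p _ => ?_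
    obtain ⟨T, hT⟩ := exists_mem_stdOpen p
    exact TopologicalSpace.Opens.mem_iSup.2 ⟨T, hT⟩
  rw [IsReduced.iff_of_openCover _ (Sextuple.openCoverOfIsOpenCover stdOpen hc)]
  exact this

instance : IsIntegral Sextuple := isIntegral_of_irreducibleSpace_of_isReduced _


lemma P1.top_le_chart_preimage (i : Fin 2) : ⊤ ≤ P1.chart i ⁻¹ᵁ P1.std i := by
  intro p _
  rw [← P1.opensRange_chart]
  exact ⟨p, rfl⟩

lemma P1.awayToSection_chart (i : Fin 2) :
    Proj.awayToSection grading (X i) ≫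
      (P1.chart i).appLE (P1.std i) ⊤ (P1.top_le_chart_preimage i) =
      (Scheme.ΓSpecIso (.of (Away i))).inv := by
  have h1 := Proj.basicOpenToSpec_app_top grading (X i : MvPolynomial (Fin 2) ℂ)
  have h2 : (P1.chart i).appLE (P1.std i) ⊤ (P1.top_le_chart_preimage i) =
      (P1.std i).topIso.inv ≫
        (Proj.basicOpenIsoSpec grading (X i) (X_mem i) one_pos).inv.appTop := by
    have h4 : (P1.std i).ι.appLE (P1.std i) ⊤ (by simp) = (P1.std i).topIso.inv := by
      simp [Scheme.Opens.ι_appLE]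
      rfl
    rw [← h4, Scheme.Hom.appTop, Scheme.Hom.app_eq_appLE]
    exact (Scheme.Hom.appLE_comp_appLE _ _ _ _ _ _ _).symm
  rw [h2]
  have h3 : Proj.awayToSection grading (X i) ≫ (P1.std i).topIso.inv =
      (Scheme.ΓSpecIso (.of (Away i))).inv ≫ (Proj.basicOpenToSpec grading (X i)).appTop := by
    rw [Iso.eq_inv_comp]; exact h1.symm
  rw [reassoc_of% h3, ← Scheme.Hom.comp_appTop, ← Proj.basicOpenIsoSpec_hom grading (X i) (X_mem i) one_pos,
    Iso.inv_hom_id]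
  simp

/-- The affine coordinate `X₁ / X₀` of the point labelled `x`, as a function on the open set where no
point of the sextuple is at infinity. -/
def stdCoord (x : Letter) : Γ(Sextuple, stdOpen 0) :=
  (pr x).appLE (P1.std 0) (stdOpen 0) (iInf_le _ x) (Proj.awayToSection grading (X 0) (Away.ratio 0 1))

lemma top_le_chart_preimage (T : Letter → Fin 2) : ⊤ ≤ chart T ⁻¹ᵁ stdOpen T := by
  intro p _
  rw [← opensRange_chart]
  exact ⟨p, rfl⟩

lemma chart_stdCoord (x : Letter) :
    (chart 0).appLE (stdOpen 0) ⊤ (top_le_chart_preimage 0) (stdCoord x) =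
      (Scheme.ΓSpecIso (.of R)).inv (X x : R) := by
  have h0 : ⊤ ≤ (Spec.map (CommRingCat.ofHom (dehomog 0 (X x : R))) ≫ P1.chart 0) ⁻¹ᵁ P1.std 0 :=
    fun p _ => P1.top_le_chart_preimage 0 trivial
  have h1 : (pr x).appLE (P1.std 0) (stdOpen 0) (iInf_le _ x) ≫
      (chart 0).appLE (stdOpen 0) ⊤ (top_le_chart_preimage 0) =
      (P1.chart 0).appLE (P1.std 0) ⊤ (P1.top_le_chart_preimage 0) ≫
        (Spec.map (CommRingCat.ofHom (dehomog 0 (X x : R)))).appTop := by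
    refine (Scheme.Hom.appLE_comp_appLE _ _ _ _ _ _ _).trans ?_
    rw [Scheme.Hom.appTop, Scheme.Hom.app_eq_appLE]
    refine Eq.trans ?_ (Scheme.Hom.appLE_comp_appLE _ _ _ _ _ _ _).symm
    have h2 := chart_pr 0 x
    simp only [Pi.zero_apply] at h2
    simp only [h2]
  have h3 := congrArg (Proj.awayToSection grading (X 0) ≫ ·) h1
  simp only [reassoc_of% (P1.awayToSection_chart 0)] at h3
  rw [← Scheme.ΓSpecIso_inv_naturality] at h3
  refine (congrArg (fun φ => φ.hom (Away.ratio 0 1)) h3).trans ?_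
  rw [CommRingCat.hom_comp, RingHom.comp_apply, CommRingCat.hom_ofHom, dehomog_ratio]
  rfl

instance : Nonempty (stdOpen 0) := ⟨⟨_, chart_unitPoint_mem 0 0⟩⟩

/-- The affine coordinate of the point labelled `x`, as a rational function on the space of
sextuples. -/
def coord (x : Letter) : Sextuple.functionField :=
  Sextuple.germToFunctionField (stdOpen 0) (stdCoord x)

/-! ### Pascal lines -/

/-- The parametrisation `t ↦ [1, t, t²]` of the conic `z₀ z₂ = z₁²`. -/
def conicPoint {K : Type*} [CommRing K] (t : K) : Fin 3 → K := ![1, t, t ^ 2]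

/-- The cross product of two vectors: the line joining two points, or the point where two lines meet,
in homogeneous coordinates. -/
def cross {K : Type*} [CommRing K] (p q : Fin 3 → K) : Fin 3 → K := crossProduct p q

/-- The cross-hair intersection point belonging to the columns `i` and `j` of the array `s`. -/
def crossHair {K : Type*} [CommRing K] (s : Fin 2 → Fin 3 → Letter) (P : Letter → Fin 3 → K)
    (i j : Fin 3) : Fin 3 → K :=
  cross (cross (P (s 0 i)) (P (s 1 j))) (cross (P (s 0 j)) (P (s 1 i)))

/-- The Pascal line of the array `s`: the line joining the cross-hair intersection points. -/
def pascalLine {K : Type*} [CommRing K] (s : Fin 2 → Fin 3 → Letter) (P : Letter → Fin 3 → K) :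
    Fin 3 → K :=
  cross (crossHair s P 0 1) (crossHair s P 0 2)

/-- The array with rows `A B C` and `F E D`. -/
def symbol : Fin 2 → Fin 3 → Letter := ![![.A, .B, .C], ![.F, .E, .D]]

lemma pascalLine_map {K L : Type*} [CommRing K] [CommRing L] (φ : K →+* L)
    (s : Fin 2 → Fin 3 → Letter) (t : Letter → K) :
    pascalLine s (fun x => conicPoint (φ (t x))) =
      φ ∘ pascalLine s (fun x => conicPoint (t x)) := by
  ext i; fin_cases i <;> simp [pascalLine, crossHair, cross, conicPoint, cross_apply]

/-- Pascal's theorem: the third cross-hair intersection point lies on the Pascal line as well. -/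
lemma pascalLine_dotProduct {K : Type*} [CommRing K] (s : Fin 2 → Fin 3 → Letter) (t : Letter → K) :
    pascalLine s (fun x => conicPoint (t x)) ⬝ᵥ crossHair s (fun x => conicPoint (t x)) 1 2 = 0 := by
  have hw (a b : K) : cross (conicPoint a) (conicPoint b) = (b - a) • ![a * b, -(a + b), 1] := by
    ext i; fin_cases i <;> simp [cross, conicPoint, cross_apply] <;> ring
  simp only [pascalLine, crossHair, hw]
  generalize t (s 0 0) = a, t (s 0 1) = b, t (s 0 2) = c, t (s 1 0) = f, t (s 1 1) = e, t (s 1 2) = d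
  simp only [cross, map_smul, LinearMap.smul_apply, smul_dotProduct, dotProduct_smul]
  have h : (crossProduct (crossProduct ![a * e, -(a + e), 1] ![b * f, -(b + f), 1])
      (crossProduct ![a * d, -(a + d), 1] ![c * f, -(c + f), 1])) ⬝ᵥ
      crossProduct ![b * d, -(b + d), 1] ![c * e, -(c + e), 1] = 0 := by
    simp [cross_apply, dotProduct, Fin.sum_univ_three]
    ring
  rw [h]
  simp

lemma pascal_ne_zero : pascalLine symbol (fun x => conicPoint (coord x)) ≠ 0 := by
  intro h
  have h1 : pascalLine symbol (fun x => conicPoint (stdCoord x)) = 0 := by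
    have hm := pascalLine_map (Sextuple.germToFunctionField (stdOpen 0)).hom symbol stdCoord
    funext i
    apply Scheme.germToFunctionField_injective Sextuple (stdOpen 0)
    rw [Pi.zero_apply, map_zero]
    exact (congrFun hm i).symm.trans (congrFun h i)
  have h2 : pascalLine symbol (fun x => conicPoint (X x : R)) = 0 := by
    have hm := pascalLine_map
      ((chart 0).appLE (stdOpen 0) ⊤ (top_le_chart_preimage 0) ≫ (Scheme.ΓSpecIso (.of R)).hom).hom
      symbol stdCoord
    have hx (x) : ((chart 0).appLE (stdOpen 0) ⊤ (top_le_chart_preimage 0) ≫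
        (Scheme.ΓSpecIso (.of R)).hom).hom (stdCoord x) = (X x : R) := by
      rw [CommRingCat.hom_comp, RingHom.comp_apply, chart_stdCoord]
      simp
    simp only [hx, h1] at hm
    rw [hm]
    funext i; simp
  have h3 := pascalLine_map (aeval (fun x : Letter => (match x with
    | .A => 0 | .B => 1 | .C => 2 | .D => 3 | .E => 4 | .F => -1 : ℂ)) : R →ₐ[ℂ] ℂ).toRingHom
    symbol (fun x => X x)
  rw [h2] at h3
  have h4 := congrFun h3 2
  simp [pascalLine, crossHair, symbol, cross, conicPoint, cross_apply] at h4
  norm_num at h4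

/-! ### Rational maps to projective space and their base schemes -/

/-- A rational map from an integral scheme `X` to `n`-dimensional projective space, given by its
homogeneous coordinates, which are rational functions on `X`, not all zero, up to a common factor. -/
abbrev RationalMapToProj (X : Scheme.{0}) [IsIntegral X] (n : ℕ) : Type :=
  Projectivization X.functionField (Fin (n + 1) → X.functionField)

/-- For an `O`-submodule `J` of a commutative `O`-algebra `K`, the ideal `J · (O : J)` of `O`. -/
def traceIdeal {O K : Type*} [CommRing O] [CommRing K] [Algebra O K] (J : Submodule O K) : Ideal O :=
  (J * (1 / J)).comap (Algebra.linearMap O K)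

lemma mul_one_div_le {O K ι : Type*} [CommRing O] [Field K] [Algebra O K] (v : ι → K) {c : K}
    (hc : c ≠ 0) : Submodule.span O (Set.range (c • v)) * (1 / Submodule.span O (Set.range (c • v))) ≤
      Submodule.span O (Set.range v) * (1 / Submodule.span O (Set.range v)) := by
  have hJ : ∀ m ∈ Submodule.span O (Set.range v), c * m ∈ Submodule.span O (Set.range (c • v)) := by
    intro m hm
    induction hm using Submodule.span_induction with
    | mem y hy => obtain ⟨i, rfl⟩ := hy; exact Submodule.subset_span ⟨i, rfl⟩
    | zero => simp
    | add y z _ _ hy hz => rw [mul_add]; exact Submodule.add_mem _ hy hz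
    | smul r y _ hy => rw [mul_smul_comm]; exact Submodule.smul_mem _ r hy
  have hJc : ∀ m ∈ Submodule.span O (Set.range (c • v)),
      c⁻¹ * m ∈ Submodule.span O (Set.range v) := by
    intro m hm
    induction hm using Submodule.span_induction with
    | mem y hy =>
      obtain ⟨i, rfl⟩ := hy
      have hi : v i ∈ Submodule.span O (Set.range v) := Submodule.subset_span ⟨i, rfl⟩
      simpa [hc] using hi
    | zero => simp
    | add y z _ _ hy hz => rw [mul_add]; exact Submodule.add_mem _ hy hz
    | smul r y _ hy => rw [mul_smul_comm]; exact Submodule.smul_mem _ r hy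
  refine Submodule.mul_le.2 fun m hm n hn => ?_
  have h : c * n ∈ 1 / Submodule.span O (Set.range v) := by
    rw [Submodule.mem_div_iff_forall_mul_mem] at hn ⊢
    intro y hy
    have := hn _ (hJ y hy)
    rwa [mul_left_comm, ← mul_assoc] at this
  have := Submodule.mul_mem_mul (hJc m hm) h
  rwa [show c⁻¹ * m * (c * n) = m * n by field_simp] at this

lemma traceIdeal_smul {O K ι : Type*} [CommRing O] [Field K] [Algebra O K] (v : ι → K) {c : K}
    (hc : c ≠ 0) : traceIdeal (Submodule.span O (Set.range (c • v))) =
      traceIdeal (Submodule.span O (Set.range v)) := by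
  rw [traceIdeal, traceIdeal]
  congr 1
  refine le_antisymm (mul_one_div_le v hc) ?_
  have := mul_one_div_le (O := O) (c • v) (inv_ne_zero hc)
  rwa [inv_smul_smul₀ hc] at this

/-- The ideal of the base scheme of a rational map in the local ring at the point `x`. Let `J` be the
fractional ideal generated by homogeneous coordinates `v₀, …, vₙ` of the map; the ideal is `J · J⁻¹`,
which does not change when the `vᵢ` are multiplied by a common factor. If the local ring is factorial,
it is the ideal generated by homogeneous coordinates `v₀, …, vₙ` of the map that lie in the local ring
and have no common factor there. -/
def baseIdealAt {X : Scheme.{0}} [IsIntegral X] {n : ℕ} (p : RationalMapToProj X n) (x : X) :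
    Ideal (X.presheaf.stalk x) :=
  Projectivization.lift
    (fun v => traceIdeal (Submodule.span (X.presheaf.stalk x) (Set.range v.1))) (by
      intro v w c h
      have hc : c ≠ 0 := by
        rintro rfl
        exact v.2 (by rw [h, zero_smul])
      simp only [h]
      exact traceIdeal_smul w.1 hc) p

/-- The indeterminacy scheme (scheme of base points) of a rational map to projective space, as a sheaf
of ideals: its sections are the functions whose germ at each point lies in the local base ideal. -/
def indeterminacy {X : Scheme.{0}} [IsIntegral X] {n : ℕ} (p : RationalMapToProj X n) :
    X.IdealSheafData :=
  Scheme.IdealSheafData.ofIdeals fun U =>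
    ⨅ x : U.1, (baseIdealAt p x.1).comap (X.presheaf.germ U.1 x.1 x.2).hom

/-- The rational map from the space of sextuples to the dual projective plane that sends a sextuple of
points of the conic to the Pascal line of the array with rows `A B C` and `F E D`. -/
def pascalMap : RationalMapToProj Sextuple 2 :=
  Projectivization.mk _ (pascalLine symbol fun x => conicPoint (coord x)) pascal_ne_zero

/-! ### Polydiagonals -/

/-- The polydiagonal of a partition of the letters, i.e. the closed subscheme of the sextuples `h` with
`h x = h y` whenever `x` and `y` belong to the same block, as a sheaf of ideals: the intersection of
the equalizers of the corresponding projections. -/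
def polydiagonal (π : Finpartition (Finset.univ : Finset Letter)) : Sextuple.IdealSheafData :=
  ⨆ (x : Letter) (y : Letter) (_ : ∃ b ∈ π.parts, x ∈ b ∧ y ∈ b),
    (equalizer.ι (pr x) (pr y)).ker

/-- The type of a partition: the multiset of the sizes of its blocks. -/
def partitionType (π : Finpartition (Finset.univ : Finset Letter)) : Multiset ℕ :=
  π.parts.val.map Finset.card

open Letter in
/-- The blocks of the six partitions. -/
def blocks : Fin 6 → Finset (Finset Letter) :=
  ![{{A, B, C}, {D}, {E}, {F}},
    {{A}, {B}, {C}, {D, E, F}},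
    {{A, B}, {C}, {D}, {E, F}},
    {{A}, {B, C}, {D, E}, {F}},
    {{A, C}, {B}, {D, F}, {E}},
    {{A, F}, {B, E}, {C, D}}]

set_option maxRecDepth 20000 in
/-- The six partitions. -/
def vartheta (i : Fin 6) : Finpartition (Finset.univ : Finset Letter) where
  parts := blocks i
  supIndep := by
    rw [Finset.supIndep_iff_pairwiseDisjoint]
    have h : ∀ i, ∀ a ∈ blocks i, ∀ b ∈ blocks i, a ≠ b → Disjoint a b := by decide
    exact fun a ha b hb hab => h i a ha b hb hab
  sup_parts := by revert i; decide
  bot_notMem := by revert i; decide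

/-! ### The explicit ideals -/

/-- The explicit coordinates `⟨u₀, u₁, u₂⟩` of the Pascal line. -/
def pascalForms {K : Type*} [CommRing K] (t : Letter → K) : Fin 3 → K :=
  let a := t .A; let b := t .B; let c := t .C; let d := t .D; let e := t .E; let f := t .F
  ![a*b*d*e - a*b*d*f - a*c*d*e + a*c*e*f + b*c*d*f - b*c*e*f,
    -a*b*e + a*b*f + a*c*d - a*c*f + a*d*f - a*e*f - b*c*d + b*c*e - b*d*e + b*e*f + c*d*e - c*d*f,
    -a*d + a*e + b*d - b*f - c*e + c*f]

/-- The ideal `(u₀, u₁, u₂)` of the polynomial ring. -/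
def pascalIdeal : Ideal R := Ideal.span (Set.range (pascalForms fun x => (X x : R)))

/-- The six linear ideals. -/
def linearIdeal : Fin 6 → Ideal R :=
  ![Ideal.span {X .B - X .C, X .A - X .C},
    Ideal.span {X .E - X .F, X .D - X .F},
    Ideal.span {X .E - X .F, X .A - X .B},
    Ideal.span {X .D - X .E, X .B - X .C},
    Ideal.span {X .D - X .F, X .A - X .C},
    Ideal.span {X .C - X .D, X .B - X .E, X .A - X .F}]

end

end Pascal

namespace Pascal

noncomputable section

open Limits MvPolynomial

/-! ### Linear ideals attached to partitions of the letters -/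

/-! The heart is the identity `(u₀, u₁, u₂) = 𝔭₁ ∩ … ∩ 𝔭₆`, proved in `iInf_diagIdeal` for any six
elements `t` of a ring satisfying `Transversal`: a difference not killed by an identification of
letters stays regular modulo that identification. This generality lets one computation serve both
the polynomial ring and the local rings of `Sextuple`. A member of the intersection is reduced by
peeling off multiples of `u₂`, first modulo `a - b` using `𝔭₁, 𝔭₃`, then modulo `d - e` using `𝔭₂,
𝔭₄`. The remaining cofactor lies in `𝔭₅ ∩ 𝔭₆`, and `(a - b)(d - e)` times that intersection is in
`(u₀, u₁, u₂)`.

The base ideal at a point is `J · (O : J)`, with `J` spanned by any homogeneous coordinates. It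
equals `J` once `J` is an ideal of `O` with trivial inverse. This holds for `(u₀, u₁, u₂)` because
each of the six ideals contains two differences, one regular modulo the other, and the intersection
contains the product (`Transversal.hasTrivialInverse`).

Points at infinity are handled by a Möbius change of coordinate: `c` is chosen away from the values
of all six letters at the given point, and `s = 1 / (t - c)` is then regular there for every letter.
The forms change by an invertible linear map and a common factor (`span_pascalForms`), and
differences of the `s x` are unit multiples of the local equations of the diagonals
(`exists_transversal`). Transversality comes from `chartIdeal_isPrime`: every polydiagonal is
integral on every standard chart.

Hence the base ideals and the stalks of the union of polydiagonals are the same intersection.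
`indeterminacy_eq` compares sections, recovering membership in each prime at the generic point of
its polydiagonal. Reducedness follows from primality on the charts. The components are irreducible
because the chart pieces of a polydiagonal share a point, and distinct because none of the six
partitions refines another. -/

/-- The ideal generated by the differences `t x - t (r x)`, for `r` a map that sends every letter to a
representative of its block. -/
def diagIdeal {O : Type*} [CommRing O] (t : Letter → O) (r : Letter → Letter) : Ideal O :=
  Ideal.span (Set.range fun x => t x - t (r x))

/-- Representatives of the blocks of the six partitions. -/
def blockRep : Fin 6 → Letter → Letter
  | 0, .A => .C | 0, .B => .C
  | 1, .D => .F | 1, .E => .F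
  | 2, .A => .B | 2, .E => .F
  | 3, .B => .C | 3, .D => .E
  | 4, .A => .C | 4, .D => .F
  | 5, .A => .F | 5, .B => .E | 5, .C => .D
  | _, x => x

/-- The differences of the `t x` are regular modulo all the ideals `diagIdeal t r` that do not contain
them for formal reasons. -/
def Transversal {O : Type*} [CommRing O] (t : Letter → O) : Prop :=
  ∀ (r : Letter → Letter), (∀ z, r (r z) = r z) → ∀ x y, r x ≠ r y → ∀ h,
    (t x - t y) * h ∈ diagIdeal t r → h ∈ diagIdeal t r

lemma blockRep_idem (i : Fin 6) (z : Letter) : blockRep i (blockRep i z) = blockRep i z := by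
  revert i z; decide

/-! ### The intersection of the six linear ideals -/

section Algebra

variable {O : Type*} [CommRing O] (t : Letter → O)

lemma diagIdeal_le {r : Letter → Letter} {J : Ideal O}
    (h : ∀ x, r x ≠ x → t x - t (r x) ∈ J) : diagIdeal t r ≤ J := by
  rw [diagIdeal, Ideal.span_le]
  rintro _ ⟨x, rfl⟩
  by_cases hx : r x = x
  · simp [hx]
  · exact h x hx

lemma diagIdeal_zero : diagIdeal t (blockRep 0) =
    Ideal.span {t .B - t .C, t .A - t .C} := by
  apply le_antisymm
  · refine diagIdeal_le t fun x hx => Ideal.subset_span ?_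
    cases x
    exacts [Or.inr rfl, Or.inl rfl, absurd rfl hx,
      absurd rfl hx, absurd rfl hx, absurd rfl hx]
  · rw [Ideal.span_le]
    rintro _ (rfl | rfl)
    exacts [Ideal.subset_span ⟨.B, rfl⟩, Ideal.subset_span ⟨.A, rfl⟩]

lemma diagIdeal_one : diagIdeal t (blockRep 1) =
    Ideal.span {t .E - t .F, t .D - t .F} := by
  apply le_antisymm
  · refine diagIdeal_le t fun x hx => Ideal.subset_span ?_
    cases x
    exacts [absurd rfl hx, absurd rfl hx, absurd rfl hx,
      Or.inr rfl, Or.inl rfl, absurd rfl hx]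
  · rw [Ideal.span_le]
    rintro _ (rfl | rfl)
    exacts [Ideal.subset_span ⟨.E, rfl⟩, Ideal.subset_span ⟨.D, rfl⟩]

lemma diagIdeal_two : diagIdeal t (blockRep 2) =
    Ideal.span {t .E - t .F, t .A - t .B} := by
  apply le_antisymm
  · refine diagIdeal_le t fun x hx => Ideal.subset_span ?_
    cases x
    exacts [Or.inr rfl, absurd rfl hx, absurd rfl hx,
      absurd rfl hx, Or.inl rfl, absurd rfl hx]
  · rw [Ideal.span_le]
    rintro _ (rfl | rfl)
    exacts [Ideal.subset_span ⟨.E, rfl⟩, Ideal.subset_span ⟨.A, rfl⟩]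

lemma diagIdeal_three : diagIdeal t (blockRep 3) =
    Ideal.span {t .D - t .E, t .B - t .C} := by
  apply le_antisymm
  · refine diagIdeal_le t fun x hx => Ideal.subset_span ?_
    cases x
    exacts [absurd rfl hx, Or.inr rfl, absurd rfl hx,
      Or.inl rfl, absurd rfl hx, absurd rfl hx]
  · rw [Ideal.span_le]
    rintro _ (rfl | rfl)
    exacts [Ideal.subset_span ⟨.D, rfl⟩, Ideal.subset_span ⟨.B, rfl⟩]

lemma diagIdeal_four : diagIdeal t (blockRep 4) =
    Ideal.span {t .D - t .F, t .A - t .C} := by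
  apply le_antisymm
  · refine diagIdeal_le t fun x hx => Ideal.subset_span ?_
    cases x
    exacts [Or.inr rfl, absurd rfl hx, absurd rfl hx,
      Or.inl rfl, absurd rfl hx, absurd rfl hx]
  · rw [Ideal.span_le]
    rintro _ (rfl | rfl)
    exacts [Ideal.subset_span ⟨.D, rfl⟩, Ideal.subset_span ⟨.A, rfl⟩]

lemma diagIdeal_five : diagIdeal t (blockRep 5) =
    Ideal.span {t .C - t .D, t .B - t .E, t .A - t .F} := by
  apply le_antisymm
  · refine diagIdeal_le t fun x hx => Ideal.subset_span ?_
    cases x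
    exacts [Or.inr (Or.inr rfl), Or.inr (Or.inl rfl), Or.inl rfl,
      absurd rfl hx, absurd rfl hx, absurd rfl hx]
  · rw [Ideal.span_le]
    rintro _ (rfl | rfl | rfl)
    exacts [Ideal.subset_span ⟨.C, rfl⟩, Ideal.subset_span ⟨.B, rfl⟩, Ideal.subset_span ⟨.A, rfl⟩]

lemma linearIdeal_eq (i : Fin 6) : linearIdeal i = diagIdeal (fun x => (X x : R)) (blockRep i) := by
  fin_cases i
  exacts [(diagIdeal_zero _).symm, (diagIdeal_one _).symm, (diagIdeal_two _).symm,
    (diagIdeal_three _).symm, (diagIdeal_four _).symm, (diagIdeal_five _).symm]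

lemma sub_mem_diagIdeal (r : Letter → Letter) {x y : Letter} (h : r x = r y) :
    t x - t y ∈ diagIdeal t r := by
  have hx : t x - t (r x) ∈ diagIdeal t r := Ideal.subset_span ⟨x, rfl⟩
  have hy : t y - t (r y) ∈ diagIdeal t r := Ideal.subset_span ⟨y, rfl⟩
  rw [← h] at hy
  simpa using sub_mem hx hy

/-- In the quotient every letter may be replaced by its representative, after which the form
vanishes identically. -/
lemma pascalForms_mem (i : Fin 6) (k : Fin 3) : pascalForms t k ∈ diagIdeal t (blockRep i) := by
  rw [← Ideal.Quotient.eq_zero_iff_mem]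
  have hm : Ideal.Quotient.mk (diagIdeal t (blockRep i)) (pascalForms t k) =
      pascalForms (fun x => Ideal.Quotient.mk (diagIdeal t (blockRep i)) (t x)) k := by
    fin_cases k <;> simp [pascalForms]
  have h (x) : Ideal.Quotient.mk (diagIdeal t (blockRep i)) (t x) =
      Ideal.Quotient.mk (diagIdeal t (blockRep i)) (t (blockRep i x)) :=
    Ideal.Quotient.eq.2 (sub_mem_diagIdeal t _ (blockRep_idem i x).symm)
  rw [hm, funext h]
  generalize Ideal.Quotient.mk (diagIdeal t (blockRep i)) = φ
  fin_cases i <;> fin_cases k <;> simp [pascalForms, blockRep] <;> ring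

/-- This is `(x, b) ∩ q ⊆ (x) + b q` for `x ∈ q` and `b` regular modulo `q`: subtracting `s x`
leaves `g b ∈ q`, and regularity gives `g ∈ q`. -/
lemma Ideal.exists_eq_of_mem_span_pair {x b f : O} {q : Ideal O} (hf : f ∈ Ideal.span {x, b})
    (hq : f ∈ q) (hx : x ∈ q) (hb : ∀ h, b * h ∈ q → h ∈ q) : ∃ s, ∃ g ∈ q, f = s * x + g * b := by
  obtain ⟨s, g, rfl⟩ := Ideal.mem_span_pair.1 hf
  refine ⟨s, g, hb _ ?_, rfl⟩
  rw [mul_comm]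
  exact (Ideal.add_mem_iff_right _ (q.mul_mem_left _ hx)).1 hq

variable {t}

/-- The form `u₂` is congruent to `(a - c)(e - f)` modulo `a - b` and to `(b - c)(e - f)` modulo `d
- e`. After subtracting a multiple of `u₂`, each linear factor can be divided out, and the quotient
stays in those ideals modulo which the factor is regular. -/
theorem iInf_diagIdeal (ht : Transversal t) :
    ⨅ i, diagIdeal t (blockRep i) = Ideal.span (Set.range (pascalForms t)) := by
  apply le_antisymm
  swap
  · refine le_iInf fun i => Ideal.span_le.2 ?_
    rintro _ ⟨k, rfl⟩
    exact pascalForms_mem t i k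
  have hT (i x y) (h : blockRep i x ≠ blockRep i y) {f} :
      (t x - t y) * f ∈ diagIdeal t (blockRep i) → f ∈ diagIdeal t (blockRep i) :=
    ht _ (blockRep_idem i) x y h f
  have hM (i x y) (h : blockRep i x = blockRep i y) : t x - t y ∈ diagIdeal t (blockRep i) :=
    sub_mem_diagIdeal t _ h
  intro f hf
  rw [Ideal.mem_iInf] at hf
  let a := t .A; let b := t .B; let c := t .C; let d := t .D; let e := t .E; let f' := t .F
  -- modulo `a - b`
  obtain ⟨h₁, g₁, hh₁, e₁⟩ : ∃ h g, (∀ i, i ≠ 0 → i ≠ 2 → h ∈ diagIdeal t (blockRep i)) ∧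
      f = g * pascalForms t 2 + (a - b) * h := by
    have h0 := hf 0
    rw [diagIdeal_zero] at h0
    -- The generators of `𝔭₁` are changed so that one of them, `a - b`, also lies in `𝔭₃`, while `a
    -- - c` is regular modulo `𝔭₃`.
    have h0' : f ∈ Ideal.span {a - b, a - c} := by
      obtain ⟨u, v, rfl⟩ := Ideal.mem_span_pair.1 h0
      exact Ideal.mem_span_pair.2 ⟨-u, u + v, by ring⟩
    obtain ⟨s, g, hg, rfl⟩ := Ideal.exists_eq_of_mem_span_pair h0' (hf 2) (hM 2 .A .B (by decide))
      fun h => hT 2 .A .C (by decide)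
    rw [diagIdeal_two] at hg
    obtain ⟨u, v, rfl⟩ := Ideal.mem_span_pair.1 hg
    -- This rests on `u₂ = (a - c)(e - f') - (a - b)(d - f')`, where `f'` is the coordinate of `F`.
    have key : s * (a - b) + (u * (t .E - t .F) + v * (t .A - t .B)) * (a - c) =
        u * pascalForms t 2 + (a - b) * (s + v * (a - c) + u * (d - f')) := by
      simp only [pascalForms, a, b, c, d, f', Matrix.cons_val]; ring
    refine ⟨_, u, fun i h0 h2 => ?_, key⟩
    apply hT i .A .B (by revert i; decide)
    have := sub_mem (hf i) (Ideal.mul_mem_left _ u (pascalForms_mem t i 2))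
    rwa [key, add_sub_cancel_left] at this
  -- modulo `d - e`
  obtain ⟨h₂, g₂, hh₂, e₂⟩ : ∃ h g, (∀ i, i = 4 ∨ i = 5 → h ∈ diagIdeal t (blockRep i)) ∧
      h₁ = g * pascalForms t 2 + (d - e) * h := by
    have h1 := hh₁ 1 (by decide) (by decide)
    rw [diagIdeal_one] at h1
    have h1' : h₁ ∈ Ideal.span {d - e, e - f'} := by
      obtain ⟨u, v, rfl⟩ := Ideal.mem_span_pair.1 h1
      exact Ideal.mem_span_pair.2 ⟨v, u + v, by ring⟩
    obtain ⟨s, g, hg, rfl⟩ := Ideal.exists_eq_of_mem_span_pair h1'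
      (hh₁ 3 (by decide) (by decide)) (hM 3 .D .E (by decide)) fun h => hT 3 .E .F (by decide)
    rw [diagIdeal_three] at hg
    obtain ⟨u, v, rfl⟩ := Ideal.mem_span_pair.1 hg
    -- This rests on `u₂ = (b - c)(e - f') - (d - e)(a - b)`.
    have key : s * (d - e) + (u * (t .D - t .E) + v * (t .B - t .C)) * (e - f') =
        v * pascalForms t 2 + (d - e) * (s + u * (e - f') + v * (a - b)) := by
      simp only [pascalForms, a, b, d, e, f', Matrix.cons_val]; ring
    refine ⟨_, v, fun i h => ?_, key⟩
    apply hT i .D .E (by revert i; decide)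
    have := sub_mem (hh₁ i (by revert i; decide) (by revert i; decide))
      (Ideal.mul_mem_left _ v (pascalForms_mem t i 2))
    rwa [key, add_sub_cancel_left] at this
  -- modulo `d - f`
  have h4 := hh₂ 4 (by decide)
  rw [diagIdeal_four] at h4
  -- The generator `a + d - c - f'` is chosen because it lies in both `𝔭₅` and `𝔭₆`, and its product
  -- with `(a - b)(d - e)` is in the ideal of the forms (`k1` below).
  have h4' : h₂ ∈ Ideal.span {a + d - c - f', d - f'} := by
    obtain ⟨u, v, rfl⟩ := Ideal.mem_span_pair.1 h4
    exact Ideal.mem_span_pair.2 ⟨v, u - v, by ring⟩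
  obtain ⟨s, g, hg, rfl⟩ := Ideal.exists_eq_of_mem_span_pair h4' (hh₂ 5 (by decide))
    (by
      have := add_mem (hM 5 .A .F (by decide)) (hM 5 .D .C (by decide))
      convert this using 1; ring)
    fun h => hT 5 .D .F (by decide)
  rw [diagIdeal_five] at hg
  obtain ⟨u, v, w, rfl⟩ := Submodule.mem_span_triple.1 hg
  -- Modulo `a + d - c - f'`, both `(d - f')(c - d)` and `(d - f')(a - f')` become `a d - c f'`, and
  -- `(d - f')(b - e)` becomes `a d - c f' + u₂`. This accounts for the coefficient `u + v + w` and
  -- the extra `v` in front of `u₂`.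
  have key : f = (a - b) * (d - e) * (a * d - c * f') * (u + v + w) +
      (a - b) * (d - e) * (a + d - c - f') * (s - u * d - v * e + w * (d - f') - w * d) +
      (g₁ + (a - b) * g₂ + (a - b) * (d - e) * v) * pascalForms t 2 := by
    rw [e₁, e₂]
    simp only [pascalForms, a, b, c, d, e, f', Matrix.cons_val]; ring
  have k0 : (a - b) * (d - e) * (a * d - c * f') = pascalForms t 0 - a * d * pascalForms t 2 := by
    simp only [pascalForms, a, b, c, d, e, f', Matrix.cons_val]; ring
  have k1 : (a - b) * (d - e) * (a + d - c - f') =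
      - (pascalForms t 1 + (a + d) * pascalForms t 2) := by
    simp only [pascalForms, a, b, c, d, e, f', Matrix.cons_val]; ring
  have hu (k) : pascalForms t k ∈ Ideal.span (Set.range (pascalForms t)) :=
    Ideal.subset_span ⟨k, rfl⟩
  rw [key, k0, k1]
  refine add_mem (add_mem (Ideal.mul_mem_right _ _ (sub_mem (hu 0) (Ideal.mul_mem_left _ _ (hu 2))))
    (Ideal.mul_mem_right _ _ (neg_mem (add_mem (hu 1) (Ideal.mul_mem_left _ _ (hu 2))))))
    (Ideal.mul_mem_left _ _ (hu 2))

end Algebra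

/-! ### Ideals with trivial inverse -/

section Trace

variable {O : Type*} [CommRing O] (K : Type*) [Field K] [Algebra O K]

/-- The ideal `J` has trivial inverse `(O : J)` in the field `K`. -/
def HasTrivialInverse (J : Ideal O) : Prop :=
  ∀ κ : K, (∀ u ∈ J, κ * algebraMap O K u ∈ Set.range (algebraMap O K)) →
    κ ∈ Set.range (algebraMap O K)

variable {K}

lemma HasTrivialInverse.mono {I J : Ideal O} (hI : HasTrivialInverse K I) (h : I ≤ J) :
    HasTrivialInverse K J :=
  fun κ hκ => hI κ fun u hu => hκ u (h hu)

lemma HasTrivialInverse.mul {I J : Ideal O} (hI : HasTrivialInverse K I)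
    (hJ : HasTrivialInverse K J) : HasTrivialInverse K (I * J) := by
  refine fun κ hκ => hI κ fun u hu => hJ _ fun v hv => ?_
  have := hκ _ (Ideal.mul_mem_mul hu hv)
  rwa [map_mul, ← mul_assoc] at this

lemma HasTrivialInverse.one : HasTrivialInverse K (1 : Ideal O) := by
  intro κ hκ
  simpa using hκ 1 (by simp)

lemma HasTrivialInverse.iInf {ι : Type*} [Fintype ι] {J : ι → Ideal O}
    (h : ∀ i, HasTrivialInverse K (J i)) : HasTrivialInverse K (⨅ i, J i) := by
  refine HasTrivialInverse.mono (I := ∏ i, J i) ?_ ?_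
  · exact Finset.prod_induction _ _ (fun _ _ => HasTrivialInverse.mul) HasTrivialInverse.one
      fun i _ => h i
  · exact Ideal.prod_le_inf.trans (by rw [Finset.inf_univ_eq_iInf])

/-- Trivial inverse means `(O : J) = O`, so `J · (O : J)` is `J` itself, and injectivity of `O → K`
returns it to an ideal of `O`. -/
lemma traceIdeal_eq [FaithfulSMul O K] {ι : Type*} (u : ι → O)
    (h : HasTrivialInverse K (Ideal.span (Set.range u))) :
    traceIdeal (Submodule.span O (Set.range fun i => algebraMap O K (u i))) =
      Ideal.span (Set.range u) := by
  have hJ : Submodule.span O (Set.range fun i => algebraMap O K (u i)) =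
      Submodule.map (Algebra.linearMap O K) (Ideal.span (Set.range u)) := by
    rw [Ideal.span, Submodule.map_span, ← Set.range_comp]
    rfl
  have h1 : 1 / Submodule.map (Algebra.linearMap O K) (Ideal.span (Set.range u)) = 1 := by
    ext κ
    rw [Submodule.mem_div_iff_forall_mul_mem]
    simp only [Submodule.mem_one]
    constructor
    · exact fun H => h κ fun v hv => H _ ⟨v, hv, rfl⟩
    · rintro ⟨k, rfl⟩ _ ⟨v, -, rfl⟩
      exact ⟨k * v, by simp⟩
  rw [traceIdeal, hJ, h1, mul_one]
  exact Submodule.comap_map_eq_of_injective (FaithfulSMul.algebraMap_injective O K) _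

variable {t : Letter → O}

/-- The map `Function.update id x y` identifies just two letters, so transversality for it is
regularity modulo a single difference. -/
lemma diagIdeal_update {x y : Letter} :
    diagIdeal t (Function.update id x y) = Ideal.span {t x - t y} := by
  apply le_antisymm
  · refine diagIdeal_le t fun z hz => ?_
    obtain rfl : z = x := by
      by_contra h
      simp [h] at hz
    simp
  · rw [Ideal.span_singleton_le_iff_mem]
    exact Ideal.subset_span ⟨x, by simp⟩

lemma diagIdeal_id : diagIdeal t id = ⊥ :=
  le_bot_iff.1 (diagIdeal_le t fun _ h => absurd rfl h)

lemma Transversal.sub_ne_zero [Nontrivial O] (ht : Transversal t) {x y : Letter} (h : x ≠ y) :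
    t x - t y ≠ 0 := by
  intro h0
  have := ht id (fun _ => rfl) x y h 1 (by simp [h0])
  rw [diagIdeal_id] at this
  exact one_ne_zero this

/-- If `κ` multiplies both differences into `O`, with products `m` and `n`, then `(t z - t w) m = (t
x - t y) n`. Regularity of `t z - t w` modulo `t x - t y` makes `m` divisible by `t x - t y`, and
the quotient is `κ`. -/
lemma Transversal.hasTrivialInverse_of_mem [Nontrivial O] [FaithfulSMul O K] (ht : Transversal t)
    {J : Ideal O} {x y z w : Letter} (hxy : x ≠ y)
    (hzw : Function.update id x y z ≠ Function.update id x y w)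
    (h₁ : t x - t y ∈ J) (h₂ : t z - t w ∈ J) : HasTrivialInverse K J := by
  intro κ hκ
  obtain ⟨m, hm⟩ := hκ _ h₁
  obtain ⟨n, hn⟩ := hκ _ h₂
  have hinj := FaithfulSMul.algebraMap_injective O K
  have hmn : (t z - t w) * m = (t x - t y) * n := by
    apply hinj
    rw [map_mul, map_mul, hm, hn]
    ring
  have hid (u : Letter) : Function.update id x y (Function.update id x y u) =
      Function.update id x y u := by
    by_cases hu : u = x
    · subst hu; simp [hxy.symm]
    · simp [hu]
  have := ht _ hid z w hzw m (by
    rw [hmn, diagIdeal_update]; exact Ideal.mul_mem_right _ _ (Ideal.mem_span_singleton_self _))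
  rw [diagIdeal_update, Ideal.mem_span_singleton] at this
  obtain ⟨c, rfl⟩ := this
  have h0 : algebraMap O K (t x - t y) ≠ 0 := by
    rw [Ne, map_eq_zero_iff _ hinj]; exact ht.sub_ne_zero hxy
  refine ⟨c, mul_left_cancel₀ h0 ?_⟩
  rw [← map_mul, hm, mul_comm]

/-- This plays the role of "no common factor" without assuming that `O` is factorial. Each ideal of
the intersection contains two suitable differences. -/
lemma Transversal.hasTrivialInverse [Nontrivial O] [FaithfulSMul O K] (ht : Transversal t) :
    HasTrivialInverse K (Ideal.span (Set.range (pascalForms t))) := by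
  rw [← iInf_diagIdeal ht]
  refine HasTrivialInverse.iInf fun i => ?_
  have hm (x y) (h : blockRep i x = blockRep i y) := sub_mem_diagIdeal t (blockRep i) h
  fin_cases i
  · exact ht.hasTrivialInverse_of_mem (x := .A) (y := .C) (z := .B) (w := .C) (by decide)
      (by decide) (hm _ _ (by decide)) (hm _ _ (by decide))
  · exact ht.hasTrivialInverse_of_mem (x := .D) (y := .F) (z := .E) (w := .F) (by decide)
      (by decide) (hm _ _ (by decide)) (hm _ _ (by decide))
  · exact ht.hasTrivialInverse_of_mem (x := .A) (y := .B) (z := .E) (w := .F) (by decide)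
      (by decide) (hm _ _ (by decide)) (hm _ _ (by decide))
  · exact ht.hasTrivialInverse_of_mem (x := .B) (y := .C) (z := .D) (w := .E) (by decide)
      (by decide) (hm _ _ (by decide)) (hm _ _ (by decide))
  · exact ht.hasTrivialInverse_of_mem (x := .A) (y := .C) (z := .D) (w := .F) (by decide)
      (by decide) (hm _ _ (by decide)) (hm _ _ (by decide))
  · exact ht.hasTrivialInverse_of_mem (x := .A) (y := .F) (z := .B) (w := .E) (by decide)
      (by decide) (hm _ _ (by decide)) (hm _ _ (by decide))

end Trace

/-! ### The explicit coordinates of the Pascal line -/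

lemma pascalLine_eq {K : Type*} [CommRing K] (t : Letter → K) :
    ∃ q : K, pascalLine symbol (fun x => conicPoint (t x)) = q • pascalForms t := by
  have hw (a b : K) : cross (conicPoint a) (conicPoint b) = (b - a) • ![a * b, -(a + b), 1] := by
    ext i; fin_cases i <;> simp [cross, conicPoint, cross_apply] <;> ring
  -- Each chord contributes a difference as common factor. The further factor `f - a` appears
  -- because for `A = F` both cross-hair points degenerate to `A`.
  have h : cross (cross ![t .A * t .E, -(t .A + t .E), 1] ![t .B * t .F, -(t .B + t .F), 1])
      (cross ![t .A * t .D, -(t .A + t .D), 1] ![t .C * t .F, -(t .C + t .F), 1]) =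
      (t .F - t .A) • pascalForms t := by
    ext i; fin_cases i <;> simp [cross, cross_apply, pascalForms] <;> ring
  refine ⟨(t .E - t .A) * (t .F - t .B) * ((t .D - t .A) * (t .F - t .C)) * (t .F - t .A), ?_⟩
  rw [mul_smul, ← h]
  simp only [pascalLine, crossHair, symbol, Matrix.cons_val, hw]
  simp only [cross, map_smul, LinearMap.smul_apply, smul_smul]
  congr 1
  ring

lemma pascalForms_map {K L : Type*} [CommRing K] [CommRing L] (φ : K →+* L) (t : Letter → K) :
    pascalForms (fun x => φ (t x)) = φ ∘ pascalForms t := by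
  ext i; fin_cases i <;> simp [pascalForms]

/-- Under the substitution `t = c + 1 / s` the coordinates of the Pascal line change by an invertible
linear transformation and a common factor. -/
lemma span_pascalForms {O K : Type*} [CommRing O] [Field K] [Algebra O K] (c : O) (s : Letter → O)
    (t : Letter → K) (hs : ∀ x, algebraMap O K (s x) * (t x - algebraMap O K c) = 1) :
    ∃ q : K, q ≠ 0 ∧ Submodule.span O (Set.range (q • pascalForms t)) =
      Submodule.span O (Set.range fun i => algebraMap O K (pascalForms s i)) := by
  have hs0 (x) : algebraMap O K (s x) ≠ 0 := left_ne_zero_of_mul_eq_one (hs x)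
  have ht (x) : t x = algebraMap O K c + (algebraMap O K (s x))⁻¹ := by
    rw [inv_eq_of_mul_eq_one_right (hs x)]; ring
  let v (i : Fin 3) : K := algebraMap O K (pascalForms s i)
  have hv : v = pascalForms fun x => algebraMap O K (s x) := (pascalForms_map _ s).symm
  have hv' : (fun i => algebraMap O K (pascalForms s i)) = v := rfl
  rw [hv']
  -- Each form has degree at most one in every letter, so the product of all `s x` clears the
  -- denominators.
  let q := algebraMap O K (s .A) * algebraMap O K (s .B) * algebraMap O K (s .C) *
    algebraMap O K (s .D) * algebraMap O K (s .E) * algebraMap O K (s .F)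
  have e2 : (q • pascalForms t) 2 = v 0 := by
    simp only [q, Pi.smul_apply, hv, pascalForms, ht, Matrix.cons_val, smul_eq_mul]
    generalize algebraMap O K c = c'
    have hA := hs0 .A; have hB := hs0 .B; have hC := hs0 .C
    have hD := hs0 .D; have hE := hs0 .E; have hF := hs0 .F
    field_simp
    ring
  have e1 : (q • pascalForms t) 1 = v 1 - 2 * algebraMap O K c * v 0 := by
    simp only [q, Pi.smul_apply, hv, pascalForms, ht, Matrix.cons_val, smul_eq_mul]
    generalize algebraMap O K c = c'
    have hA := hs0 .A; have hB := hs0 .B; have hC := hs0 .C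
    have hD := hs0 .D; have hE := hs0 .E; have hF := hs0 .F
    field_simp
    ring
  have e0 : (q • pascalForms t) 0 =
      v 2 - algebraMap O K c * v 1 + algebraMap O K c ^ 2 * v 0 := by
    simp only [q, Pi.smul_apply, hv, pascalForms, ht, Matrix.cons_val, smul_eq_mul]
    generalize algebraMap O K c = c'
    have hA := hs0 .A; have hB := hs0 .B; have hC := hs0 .C
    have hD := hs0 .D; have hE := hs0 .E; have hF := hs0 .F
    field_simp
    ring
  refine ⟨q, by simp only [q, ne_eq, mul_eq_zero, hs0, or_self, not_false_eq_true], ?_⟩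
  generalize q • pascalForms t = w at e0 e1 e2
  -- Up to reversing the order, the transition is unitriangular with entries in `O`, hence
  -- invertible over `O`.
  have f0 : v 0 = w 2 := e2.symm
  have f1 : v 1 = w 1 + (2 * c) • w 2 := by
    rw [e1, e2, Algebra.smul_def, map_mul, map_ofNat]; ring
  have f2 : v 2 = w 0 + c • w 1 + c ^ 2 • w 2 := by
    rw [e0, e1, e2, Algebra.smul_def, Algebra.smul_def, map_pow]; ring
  have e1' : w 1 = v 1 - (2 * c) • v 0 := by
    rw [e1, Algebra.smul_def, map_mul, map_ofNat]
  have e0' : w 0 = v 2 - c • v 1 + c ^ 2 • v 0 := by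
    rw [e0, Algebra.smul_def, Algebra.smul_def, map_pow]
  have hw (i) : w i ∈ Submodule.span O (Set.range w) := Submodule.subset_span ⟨i, rfl⟩
  have hv (i) : v i ∈ Submodule.span O (Set.range v) := Submodule.subset_span ⟨i, rfl⟩
  apply le_antisymm <;> rw [Submodule.span_le] <;> rintro _ ⟨i, rfl⟩ <;> rw [SetLike.mem_coe]
  · fin_cases i
    · exact e0' ▸ add_mem (sub_mem (hv 2) (Submodule.smul_mem _ _ (hv 1)))
        (Submodule.smul_mem _ _ (hv 0))
    · exact e1' ▸ sub_mem (hv 1) (Submodule.smul_mem _ _ (hv 0))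
    · exact e2 ▸ hv 0
  · fin_cases i
    · exact f0 ▸ hw 2
    · exact f1 ▸ add_mem (hw 1) (Submodule.smul_mem _ _ (hw 2))
    · exact f2 ▸ add_mem (add_mem (hw 0) (Submodule.smul_mem _ _ (hw 1)))
        (Submodule.smul_mem _ _ (hw 2))

lemma pascalForms_coord_ne_zero : pascalForms coord ≠ 0 := by
  intro h
  obtain ⟨q, hq⟩ := pascalLine_eq coord
  exact pascal_ne_zero (by rw [hq, h, smul_zero])

lemma pascalMap_eq : pascalMap =
    Projectivization.mk _ (pascalForms coord) pascalForms_coord_ne_zero := by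
  obtain ⟨q, hq⟩ := pascalLine_eq coord
  exact (Projectivization.mk_eq_mk_iff' ..).2 ⟨q, hq.symm⟩

/-! ### Equations of the polydiagonals on the standard charts -/

/-- The equation of the condition `h x = h y` in the coordinates `t` of the chart with index `T`. -/
def rel {A : Type*} [CommRing A] (T : Letter → Fin 2) (t : Letter → A) (x y : Letter) : A :=
  if T x = T y then t x - t y else t x * t y - 1

/-- The ideal of a polydiagonal in the coordinates `t` of the chart with index `T`. -/
def chartIdeal {A : Type*} [CommRing A] (T : Letter → Fin 2) (t : Letter → A)
    (r : Letter → Letter) : Ideal A :=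
  Ideal.span (Set.range fun x => rel T t x (r x))

lemma Fin.eq_zero_or_one (i : Fin 2) : i = 0 ∨ i = 1 := by
  revert i; decide

lemma rel_map {A B : Type*} [CommRing A] [CommRing B] (φ : A →+* B) (T : Letter → Fin 2)
    (t : Letter → A) (x y : Letter) : rel T (fun x => φ (t x)) x y = φ (rel T t x y) := by
  unfold rel; split_ifs <;> simp

lemma chartIdeal_map {A B : Type*} [CommRing A] [CommRing B] (φ : A →+* B) (T : Letter → Fin 2)
    (t : Letter → A) (r : Letter → Letter) :
    (chartIdeal T t r).map φ = chartIdeal T (fun x => φ (t x)) r := by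
  simp only [chartIdeal, Ideal.map_span, ← Set.range_comp, rel_map]
  rfl

lemma chartIdeal_const {A : Type*} [CommRing A] (t : Letter → A) (r : Letter → Letter) :
    chartIdeal 0 t r = diagIdeal t r := rfl

/-- The coordinate of the common representative is eliminated from the two generators; the eight
cases record which of the three letters are read in which affine coordinate. -/
lemma rel_mem_chartIdeal {A : Type*} [CommRing A] (T : Letter → Fin 2) (t : Letter → A)
    (r : Letter → Letter) {x y : Letter} (h : r x = r y) : rel T t x y ∈ chartIdeal T t r := by
  have hx : rel T t x (r x) ∈ chartIdeal T t r := Ideal.subset_span ⟨x, rfl⟩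
  have hy : rel T t y (r x) ∈ chartIdeal T t r := by rw [h]; exact Ideal.subset_span ⟨y, rfl⟩
  generalize r x = z at hx hy
  unfold rel at hx hy ⊢
  rcases Fin.eq_zero_or_one (T x) with h1 | h1 <;> rcases Fin.eq_zero_or_one (T y) with h2 | h2 <;>
    rcases Fin.eq_zero_or_one (T z) with h3 | h3 <;>
    simp only [h1, h2, h3, Fin.isValue, zero_ne_one, one_ne_zero, ↓reduceIte] at hx hy ⊢
  · convert sub_mem hx hy using 1; ring
  · convert sub_mem (Ideal.mul_mem_left _ (t y) hx) (Ideal.mul_mem_left _ (t x) hy) using 1; ring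
  · convert add_mem (Ideal.mul_mem_left _ (t y) hx) hy using 1; ring
  · convert add_mem (Ideal.mul_mem_left _ (t x) hy) hx using 1; ring
  · convert add_mem (Ideal.mul_mem_left _ (t x) hy) hx using 1; ring
  · convert add_mem (Ideal.mul_mem_left _ (t y) hx) hy using 1; ring
  · convert sub_mem (Ideal.mul_mem_left _ (t y) hx) (Ideal.mul_mem_left _ (t x) hy) using 1; ring
  · convert sub_mem hx hy using 1; ring

lemma chartIdeal_le_ker {A B : Type*} [CommRing A] [CommRing B] (φ : A →+* B) (T : Letter → Fin 2)
    (t : Letter → A) (r : Letter → Letter) (h : ∀ x, rel T (fun x => φ (t x)) x (r x) = 0) :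
    chartIdeal T t r ≤ RingHom.ker φ := by
  rw [chartIdeal, Ideal.span_le]
  rintro _ ⟨x, rfl⟩
  rw [SetLike.mem_coe, RingHom.mem_ker, ← rel_map, h]

/-- The ideal of a polydiagonal on a standard chart is prime. -/
lemma chartIdeal_isPrime (T : Letter → Fin 2) {r : Letter → Letter} (hr : ∀ z, r (r z) = r z) :
    (chartIdeal T (X : Letter → R) r).IsPrime := by
  let q := chartIdeal T (X : Letter → R) r
  -- If `x` and its representative are read in different coordinates, the equation is `X x * X (r x)
  -- = 1`, so exactly these representatives must become invertible.
  let M : Submonoid R := Submonoid.closure {p | ∃ x, T x ≠ T (r x) ∧ p = X (r x)}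
  let L := Localization M
  have hM : M ≤ nonZeroDivisors R := by
    refine Submonoid.closure_le.2 ?_
    rintro _ ⟨x, -, rfl⟩
    exact mem_nonZeroDivisors_of_ne_zero (X_ne_zero _)
  have : IsDomain L := IsLocalization.isDomain_localization hM
  have hu {x} (h : T x ≠ T (r x)) : IsUnit (algebraMap R L (X (r x))) :=
    IsLocalization.map_units L (⟨_, Submonoid.subset_closure ⟨x, h, rfl⟩⟩ : M)
  let α : R →+* L := eval₂Hom ((algebraMap R L).comp C) fun x =>
    if T x = T (r x) then algebraMap R L (X (r x)) else Ring.inverse (algebraMap R L (X (r x)))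
  have hα x : α (X x) = if T x = T (r x) then algebraMap R L (X (r x)) else
    Ring.inverse (algebraMap R L (X (r x))) := eval₂Hom_X' _ _ _
  have hq {x} (h : T x = T (r x)) : Ideal.Quotient.mk q (X x) = Ideal.Quotient.mk q (X (r x)) := by
    rw [Ideal.Quotient.eq]
    have : rel T (X : Letter → R) x (r x) ∈ q := Ideal.subset_span ⟨x, rfl⟩
    rwa [rel, if_pos h] at this
  have hq' {x} (h : T x ≠ T (r x)) :
      Ideal.Quotient.mk q (X x) * Ideal.Quotient.mk q (X (r x)) = 1 := by
    rw [← map_mul, ← map_one (Ideal.Quotient.mk q), Ideal.Quotient.eq]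
    have : rel T (X : Letter → R) x (r x) ∈ q := Ideal.subset_span ⟨x, rfl⟩
    rwa [rel, if_neg h] at this
  -- The map `α` eliminates all letters except representatives. Going back by `β` recovers the
  -- quotient map, so the kernel of `α` is no larger than `q`, and `q` is prime because `L` is a
  -- domain.
  let β : L →+* R ⧸ q := IsLocalization.lift (M := M) (g := Ideal.Quotient.mk q) (by
    rintro ⟨y, hy⟩
    induction hy using Submonoid.closure_induction with
    | mem _ h =>
      obtain ⟨x, hx, rfl⟩ := h
      exact IsUnit.of_mul_eq_one _ ((mul_comm _ _).trans (hq' hx))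
    | one => simp
    | mul a b _ _ ha hb => simpa using ha.mul hb)
  have hβ p : β (algebraMap R L p) = Ideal.Quotient.mk q p := IsLocalization.lift_eq _ _
  have hβα : β.comp α = Ideal.Quotient.mk q := by
    apply MvPolynomial.ringHom_ext
    · intro c
      simp only [RingHom.comp_apply, α, coe_eval₂Hom, eval₂_C, hβ]
    · intro x
      rw [RingHom.comp_apply, hα]
      split_ifs with h
      · rw [hβ, hq h]
      · have h1 : β (Ring.inverse (algebraMap R L (X (r x)))) * Ideal.Quotient.mk q (X (r x)) = 1 := by
          rw [← hβ, ← map_mul, Ring.inverse_mul_cancel _ (hu h), map_one]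
        have h2 := hq' h
        exact (left_inv_eq_right_inv h1 ((mul_comm _ _).trans h2))
  have hker : q = RingHom.ker α := by
    apply le_antisymm
    · refine chartIdeal_le_ker α T _ r fun x => ?_
      have h1 : α (X (r x)) = algebraMap R L (X (r x)) := by rw [hα, hr, if_pos rfl]
      rw [rel, h1, hα]
      split_ifs with h
      · rw [sub_self]
      · rw [Ring.inverse_mul_cancel _ (hu h), sub_self]
    · intro p hp
      rw [RingHom.mem_ker] at hp
      rw [← Ideal.Quotient.eq_zero_iff_mem, ← hβα, RingHom.comp_apply, hp, map_zero]
  change q.IsPrime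
  rw [hker]
  exact RingHom.ker_isPrime α

/-- A test point on the polydiagonal separates the blocks: the letters receive six distinct values
and each letter takes that of its representative. The values are nonzero so that they can be read in
either affine coordinate. -/
lemma rel_notMem_chartIdeal (T : Letter → Fin 2) {r : Letter → Letter} (hr : ∀ z, r (r z) = r z)
    {x y : Letter} (h : r x ≠ r y) :
    rel T (X : Letter → R) x y ∉ chartIdeal T (X : Letter → R) r := by
  let w : Letter → ℂ := fun
    | .A => 1 | .B => 2 | .C => 3 | .D => 4 | .E => 5 | .F => 6
  have hw0 z : w z ≠ 0 := by cases z <;> simp [w]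
  have hw : Function.Injective w := by
    intro u v; cases u <;> cases v <;> simp [w]
  let φ : R →+* ℂ := eval₂Hom (RingHom.id ℂ) fun x => if T x = 0 then w (r x) else (w (r x))⁻¹
  have hφ x : φ (X x) = if T x = 0 then w (r x) else (w (r x))⁻¹ := eval₂Hom_X' _ _ _
  have key (x y) : rel T (fun x => φ (X x)) x y = 0 ↔ w (r x) = w (r y) := by
    have hx := hw0 (r x)
    have hy := hw0 (r y)
    rcases Fin.eq_zero_or_one (T x) with h1 | h1 <;> rcases Fin.eq_zero_or_one (T y) with h2 | h2 <;>
      simp only [rel, hφ, h1, h2, Fin.isValue, zero_ne_one, one_ne_zero, ↓reduceIte]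
    · exact sub_eq_zero
    · rw [sub_eq_zero, mul_inv_eq_one₀ hy]
    · rw [sub_eq_zero, inv_mul_eq_one₀ hx]
    · rw [sub_eq_zero, inv_inj]
  intro hm
  have hle := chartIdeal_le_ker φ T X r fun x => (key _ _).2 (by rw [hr])
  have h0 := hle hm
  rw [RingHom.mem_ker, ← rel_map, key] at h0
  exact h (hw h0)

/-- An inclusion forces each block of the first partition into a block of the second; a finite check
shows that this never happens between different partitions of the list. -/
lemma chartIdeal_zero_le_iff (i j : Fin 6) (h : chartIdeal 0 (X : Letter → R) (blockRep i) ≤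
    chartIdeal 0 (X : Letter → R) (blockRep j)) : i = j := by
  have h1 : ∀ x, blockRep j x = blockRep j (blockRep i x) := by
    intro x
    by_contra hx
    exact rel_notMem_chartIdeal 0 (blockRep_idem j) hx (h (Ideal.subset_span ⟨x, rfl⟩))
  revert i j
  have : ∀ i j : Fin 6, (∀ x, blockRep j x = blockRep j (blockRep i x)) → i = j := by decide
  exact fun i j _ h => this i j h

lemma mem_map_of_mul_mem_map {A O : Type*} [CommRing A] [CommRing O] [Algebra A O]
    (M : Submonoid A) [IsLocalization M O] {q : Ideal A} [q.IsPrime] {g : A} (hg : g ∉ q) {h : O}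
    (hm : algebraMap A O g * h ∈ q.map (algebraMap A O)) : h ∈ q.map (algebraMap A O) := by
  obtain ⟨a, m, rfl⟩ := IsLocalization.exists_mk'_eq M h
  rw [IsLocalization.mul_mk'_eq_mk'_of_mul, IsLocalization.mk'_mem_map_algebraMap_iff] at hm
  rw [IsLocalization.mk'_mem_map_algebraMap_iff]
  obtain ⟨u, hu, hm⟩ := hm
  refine ⟨u, hu, ?_⟩
  rw [mul_left_comm] at hm
  exact (Ideal.IsPrime.mem_or_mem ‹_› hm).resolve_left hg

/-- The denominator of the coordinate `1 / (t - c)` on the chart with index `T`. -/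
def denom {A : Type*} [CommRing A] (T : Letter → Fin 2) (t : Letter → A) (c : A) (x : Letter) : A :=
  if T x = 0 then t x - c else 1 - c * t x

/-- Each letter excludes at most one `c`: two excluded constants would put a nonzero constant, or `X
x` and then `1`, in `P`. Since `ℂ` is infinite, some `c` avoids all six. -/
lemma exists_denom_notMem (T : Letter → Fin 2) (P : Ideal R) [P.IsPrime] :
    ∃ c : ℂ, ∀ x, denom T X (C c : R) x ∉ P := by
  have hfin : (⋃ x : Letter, {c : ℂ | denom T X (C c : R) x ∈ P}).Finite := by
    refine Set.finite_iUnion fun x => Set.Subsingleton.finite fun c hc c' hc' => ?_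
    by_contra hne
    have hunit : C (c - c') ∉ P := fun h => Ideal.IsPrime.ne_top ‹_›
      (Ideal.eq_top_of_isUnit_mem _ h ((isUnit_iff_ne_zero.2 (sub_ne_zero.2 hne)).map C))
    rw [Set.mem_ofPred_eq, denom] at hc hc'
    split_ifs at hc hc'
    · apply hunit
      convert sub_mem hc' hc using 1
      rw [C_sub]; ring
    · have hX : C (c - c') * X x ∈ P := by
        convert sub_mem hc' hc using 1
        rw [C_sub]; ring
      have hX' := (Ideal.IsPrime.mem_or_mem ‹_› hX).resolve_left hunit
      refine Ideal.IsPrime.ne_top ‹_› ((Ideal.eq_top_iff_one _).2 ?_)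
      convert add_mem hc (P.mul_mem_left (C c) hX') using 1
      ring
  obtain ⟨c, hc⟩ := hfin.exists_notMem
  exact ⟨c, fun x hx => hc (Set.mem_iUnion.2 ⟨x, hx⟩)⟩

/-- The element `s x` is `1 / (t - c)` for the affine coordinate `t` of the point `x`: in the chart
at infinity, with `X x = 1 / t`, it reads `X x / (1 - c X x)`. The equation of a diagonal becomes,
up to a unit, a plain difference in these coordinates whatever `T` is, so transversality follows
from primality of the chart ideals. -/
lemma exists_transversal (T : Letter → Fin 2) (P : Ideal R) [P.IsPrime] (O : Type*) [CommRing O]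
    [Algebra R O] [IsLocalization.AtPrime O P] : ∃ (c : ℂ) (s : Letter → O), Transversal s ∧
      (∀ r, diagIdeal s r = (chartIdeal T X r).map (algebraMap R O)) ∧
      ∀ x, s x * algebraMap R O (denom T X (C c) x) =
        if T x = 0 then 1 else algebraMap R O (X x) := by
  obtain ⟨c, hc⟩ := exists_denom_notMem T P
  have hu x : IsUnit (algebraMap R O (denom T X (C c) x)) :=
    IsLocalization.map_units O (⟨_, hc x⟩ : P.primeCompl)
  choose v hv using fun x => (hu x).exists_right_inv
  let s : Letter → O := fun x => (if T x = 0 then 1 else algebraMap R O (X x)) * v x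
  have hs x : s x * algebraMap R O (denom T X (C c) x) =
      if T x = 0 then 1 else algebraMap R O (X x) := by
    simp only [s]
    rw [mul_assoc, mul_comm (v x), hv, mul_one]
  have hsub x y : ∃ u : O, IsUnit u ∧ s x - s y = u * algebraMap R O (rel T X x y) := by
    have huv x : IsUnit (v x) := IsUnit.of_mul_eq_one _ ((mul_comm _ _).trans (hv x))
    refine ⟨(if T x = 0 then -1 else 1) * (v x * v y), ?_, ?_⟩
    · refine IsUnit.mul ?_ ((huv x).mul (huv y))
      split_ifs <;> simp
    · have hx := hv x
      have hy := hv y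
      simp only [s]
      unfold denom at hx hy
      unfold rel
      generalize hX : algebraMap R O (X x) = a at hx ⊢
      generalize hY : algebraMap R O (X y) = b at hy ⊢
      generalize hC : algebraMap R O (C c) = c' at hx hy
      rcases Fin.eq_zero_or_one (T x) with h1 | h1 <;>
        rcases Fin.eq_zero_or_one (T y) with h2 | h2 <;>
        simp only [h1, h2, Fin.isValue, zero_ne_one, one_ne_zero, ↓reduceIte, map_sub, map_mul,
          map_one, hX, hY, hC] at hx hy ⊢
      · linear_combination v y * hx - v x * hy
      · linear_combination b * v y * hx - v x * hy
      · linear_combination v y * hx - a * v x * hy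
      · linear_combination b * v y * hx - a * v x * hy
  have hdiag r : diagIdeal s r = (chartIdeal T X r).map (algebraMap R O) := by
    rw [chartIdeal_map]
    apply le_antisymm
    · rw [diagIdeal, Ideal.span_le]
      rintro _ ⟨x, rfl⟩
      obtain ⟨u, -, hxy⟩ := hsub x (r x)
      simp only [SetLike.mem_coe, hxy]
      exact Ideal.mul_mem_left _ _ (Ideal.subset_span ⟨x, rel_map _ _ _ _ _⟩)
    · rw [chartIdeal, Ideal.span_le]
      rintro _ ⟨x, rfl⟩
      obtain ⟨u, hu, hxy⟩ := hsub x (r x)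
      simp only [SetLike.mem_coe, rel_map]
      rw [← Ideal.unit_mul_mem_iff_mem _ hu, ← hxy]
      exact Ideal.subset_span ⟨x, rfl⟩
  refine ⟨c, s, fun r hr x y hne h hm => ?_, hdiag, hs⟩
  obtain ⟨u, hu, hxy⟩ := hsub x y
  have := chartIdeal_isPrime T hr
  rw [hdiag] at hm ⊢
  rw [hxy, mul_assoc, Ideal.unit_mul_mem_iff_mem _ hu] at hm
  exact mem_map_of_mul_mem_map P.primeCompl (rel_notMem_chartIdeal T hr hne) hm

/-- The ideal of base points in the local ring at a point of a standard chart. -/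
theorem traceIdeal_span_pascalForms (T : Letter → Fin 2) (P : Ideal R) [P.IsPrime] (O K : Type*)
    [CommRing O] [IsDomain O] [Field K] [Algebra R O] [IsLocalization.AtPrime O P] [Algebra O K]
    [FaithfulSMul O K] (k : Letter → K)
    (hk : ∀ x, if T x = 0 then k x = algebraMap O K (algebraMap R O (X x)) else
      k x * algebraMap O K (algebraMap R O (X x)) = 1) :
    traceIdeal (Submodule.span O (Set.range (pascalForms k))) =
      ⨅ i, (chartIdeal T X (blockRep i)).map (algebraMap R O) := by
  obtain ⟨c, s, ht, hd, hs⟩ := exists_transversal T P O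
  obtain ⟨q, hq, hspan⟩ := span_pascalForms (algebraMap R O (C c)) s k (fun x => by
    have h1 := congrArg (algebraMap O K) (hs x)
    have h2 := hk x
    unfold denom at h1
    rcases Fin.eq_zero_or_one (T x) with h | h <;>
      simp only [h, Fin.isValue, one_ne_zero, ↓reduceIte, map_sub, map_mul, map_one] at h1 h2
    · rw [h2, h1]
    · linear_combination k x * h1 + (1 + algebraMap O K (s x) * algebraMap O K (algebraMap R O (C c))) * h2)
  -- The coordinates `k` are exchanged for the regular coordinates `s`, where the inverse ideal is
  -- trivial and the intersection formula applies.
  rw [← traceIdeal_smul _ hq, hspan, traceIdeal_eq _ ht.hasTrivialInverse, ← iInf_diagIdeal ht]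
  simp only [hd]

/-! ### Gluing of the standard charts of the projective line -/

/-- The coordinate ring of `D₊(Xᵢ Xⱼ)`. -/
abbrev AwayMul (i j : Fin 2) :=
  HomogeneousLocalization.Away grading (X i * X j : MvPolynomial (Fin 2) ℂ)

/-- The restriction of functions from `D₊(Xᵢ)` to `D₊(Xᵢ Xⱼ)`. -/
abbrev awayLeft (i j : Fin 2) : Away i →+* AwayMul i j :=
  HomogeneousLocalization.awayMap grading (X_mem j) rfl

/-- The restriction of functions from `D₊(Xⱼ)` to `D₊(Xᵢ Xⱼ)`. -/
abbrev awayRight (i j : Fin 2) : Away j →+* AwayMul i j :=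
  HomogeneousLocalization.awayMap grading (X_mem i) (mul_comm _ _)

lemma awayLeft_mul_awayRight (i j : Fin 2) :
    awayLeft i j (Away.ratio i j) * awayRight i j (Away.ratio j i) = 1 := by
  rw [Away.ratio, Away.ratio, HomogeneousLocalization.awayMap_mk, HomogeneousLocalization.awayMap_mk]
  apply HomogeneousLocalization.val_injective
  rw [HomogeneousLocalization.val_mul, HomogeneousLocalization.Away.val_mk,
    HomogeneousLocalization.Away.val_mk, HomogeneousLocalization.val_one, Localization.mk_mul,
    ← Localization.mk_one, Localization.mk_eq_mk_iff, Localization.r_iff_exists]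
  exact ⟨1, by simp; ring⟩

lemma awayLeft_const (i j : Fin 2) :
    (awayLeft i j).comp (Away.const i) = (awayRight i j).comp (Away.const j) := by
  refine RingHom.ext fun c => ?_
  exact (HomogeneousLocalization.awayMap_fromZeroRingHom grading (X_mem j) rfl _).trans
    (HomogeneousLocalization.awayMap_fromZeroRingHom grading (X_mem i) (mul_comm _ _) _).symm

lemma awayι_left (i j : Fin 2) : Spec.map (CommRingCat.ofHom (awayLeft i j)) ≫ P1.chart i =
    Spec.map (CommRingCat.ofHom (awayRight i j)) ≫ P1.chart j := by
  rw [P1.chart, P1.chart, Proj.SpecMap_awayMap_awayι, Proj.SpecMap_awayMap_awayι]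

lemma isLocalizationElem_eq (i j : Fin 2) :
    HomogeneousLocalization.Away.isLocalizationElem (X_mem i) (X_mem j) = Away.ratio i j := by
  rw [HomogeneousLocalization.Away.isLocalizationElem, Away.mk_eq, pow_one, eval₂_X]

/-- Agreement in `P1` means factoring through the overlap `D₊(XᵢXⱼ)`, where the two ratios are
inverse to each other. -/
lemma ratio_mul_of_chart_eq {Z : Scheme.{0}} {i j : Fin 2} {f : Z ⟶ Spec (.of (Away i))}
    {g : Z ⟶ Spec (.of (Away j))} (h : f ≫ P1.chart i = g ≫ P1.chart j) :
    sharp f (Away.ratio i j) * sharp g (Away.ratio j i) = 1 := by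
  let e := Proj.pullbackAwayιIso grading (X_mem i) one_pos (X_mem j) one_pos rfl
  let l : Z ⟶ Spec (.of (AwayMul i j)) := pullback.lift f g h ≫ e.hom
  have hf : f = l ≫ Spec.map (CommRingCat.ofHom (awayLeft i j)) := by
    rw [Category.assoc, Proj.pullbackAwayιIso_hom_SpecMap_awayMap_left, pullback.lift_fst]
  have hg : g = l ≫ Spec.map (CommRingCat.ofHom (awayRight i j)) := by
    rw [Category.assoc, Proj.pullbackAwayιIso_hom_SpecMap_awayMap_right, pullback.lift_snd]
  rw [hf, hg, sharp_comp, sharp_comp, RingHom.comp_apply, RingHom.comp_apply, ← map_mul,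
    awayLeft_mul_awayRight, map_one]

/-- Invertibility of the ratio lifts `f` to the overlap. Uniqueness of inverses, together with
agreement on constants, forces `g` to be the other projection of that lift. -/
lemma chart_eq_of_ratio_mul {Z : Scheme.{0}} {i j : Fin 2} {f : Z ⟶ Spec (.of (Away i))}
    {g : Z ⟶ Spec (.of (Away j))}
    (hc : (sharp f).comp (Away.const i) = (sharp g).comp (Away.const j))
    (h : sharp f (Away.ratio i j) * sharp g (Away.ratio j i) = 1) (hij : i ≠ j) :
    f ≫ P1.chart i = g ≫ P1.chart j := by
  let : Algebra (Away i) (AwayMul i j) := (awayLeft i j).toAlgebra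
  have : IsLocalization.Away (Away.ratio i j) (AwayMul i j) := by
    rw [← isLocalizationElem_eq]
    exact HomogeneousLocalization.Away.isLocalization_mul (X_mem i) (X_mem j) rfl one_ne_zero
  have hu : IsUnit (sharp f (Away.ratio i j)) := IsUnit.of_mul_eq_one _ h
  obtain ⟨l, hl⟩ := exists_sharp_eq (Z := Z) (A := AwayMul i j)
    (IsLocalization.Away.lift (S := AwayMul i j) (Away.ratio i j) hu)
  have hlf : (sharp l).comp (awayLeft i j) = sharp f := by
    rw [hl]; exact IsLocalization.Away.lift_comp _ hu
  have hf : f = l ≫ Spec.map (CommRingCat.ofHom (awayLeft i j)) :=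
    hom_ext_sharp (by rw [sharp_comp, hlf])
  have hg : g = l ≫ Spec.map (CommRingCat.ofHom (awayRight i j)) := by
    apply hom_ext_sharp
    rw [sharp_comp]
    apply Away.hom_ext
    · rw [← hc, RingHom.comp_assoc, ← awayLeft_const, ← RingHom.comp_assoc, hlf]
    · intro k
      by_cases hk : k = j
      · subst hk; simp
      · obtain rfl : k = i := by
          have (i j k : Fin 2) : i ≠ j → k ≠ j → k = i := by revert i j k; decide
          exact this i j k hij hk
        refine (left_inv_eq_right_inv (a := sharp f (Away.ratio k j)) ?_ h).symm
        rw [mul_comm, ← hlf, RingHom.comp_apply, RingHom.comp_apply, ← map_mul,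
          awayLeft_mul_awayRight, map_one]
  rw [hf, hg, Category.assoc, Category.assoc, awayι_left]

/-- The coordinates of a morphism to a standard chart of the space of sextuples. -/
def coords {Z : Scheme.{0}} (f : Z ⟶ Spec (.of R)) (x : Letter) : Γ(Z, ⊤) := sharp f (X x)

/-- With `f = g` and `T = S` this gives the equations of the diagonals; with `x = y` it gives the
change of coordinates between charts. -/
lemma chart_pr_eq_iff {Z : Scheme.{0}} (f g : Z ⟶ Spec (.of R)) (T S : Letter → Fin 2)
    (hfg : f ≫ Spec.map (CommRingCat.ofHom (algebraMap ℂ R)) =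
      g ≫ Spec.map (CommRingCat.ofHom (algebraMap ℂ R))) (x y : Letter) :
    f ≫ chart T ≫ pr x = g ≫ chart S ≫ pr y ↔ if T x = S y then coords f x = coords g y else
      coords f x * coords g y = 1 := by
  rw [chart_pr, chart_pr]
  let f' := f ≫ Spec.map (CommRingCat.ofHom (dehomog (T x) (X x : R)))
  let g' := g ≫ Spec.map (CommRingCat.ofHom (dehomog (S y) (X y : R)))
  have hf' k : sharp f' (Away.ratio (T x) k) = if k = T x then 1 else coords f x := by
    simp only [f', sharp_comp, RingHom.comp_apply, dehomog_ratio]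
    split_ifs <;> simp [coords]
  have hg' k : sharp g' (Away.ratio (S y) k) = if k = S y then 1 else coords g y := by
    simp only [g', sharp_comp, RingHom.comp_apply, dehomog_ratio]
    split_ifs <;> simp [coords]
  have hc : (sharp f').comp (Away.const (T x)) = (sharp g').comp (Away.const (S y)) := by
    have := congrArg sharp hfg
    rw [sharp_comp, sharp_comp] at this
    simpa only [f', g', sharp_comp, RingHom.comp_assoc, dehomog_const] using this
  change f' ≫ P1.chart (T x) = g' ≫ P1.chart (S y) ↔ _
  generalize T x = i at f' hf' hc ⊢
  generalize S y = j at g' hg' hc ⊢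
  split_ifs with h
  · subst h
    rw [cancel_mono]
    constructor
    · intro h
      have h1 := hf' (i + 1)
      rw [h, hg'] at h1
      simpa using h1.symm
    · intro h
      exact hom_ext_sharp (Away.hom_ext hc fun k => by rw [hf', hg', h])
  · rw [show coords f x = sharp f' (Away.ratio i j) by rw [hf', if_neg (Ne.symm h)],
      show coords g y = sharp g' (Away.ratio j i) by rw [hg', if_neg h]]
    exact ⟨ratio_mul_of_chart_eq, fun h' => chart_eq_of_ratio_mul hc h' h⟩

/-! ### Functions on the standard charts of the space of sextuples -/

lemma isAffineOpen_stdOpen (T : Letter → Fin 2) : IsAffineOpen (stdOpen T) := by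
  rw [← opensRange_chart]
  exact isAffineOpen_opensRange (chart T)

/-- The standard charts as affine open subsets. -/
abbrev stdAffine (T : Letter → Fin 2) : Sextuple.affineOpens := ⟨stdOpen T, isAffineOpen_stdOpen T⟩

lemma iSup_stdAffine : ⨆ T, (stdAffine T).1 = ⊤ := by
  refine top_le_iff.1 fun p _ => ?_
  obtain ⟨T, hT⟩ := exists_mem_stdOpen p
  exact TopologicalSpace.Opens.mem_iSup.2 ⟨T, hT⟩

instance (T : Letter → Fin 2) :
    IsIso ((chart T).appLE (stdOpen T) ⊤ (top_le_chart_preimage T)) := by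
  have : IsIso ((chart T).app (stdOpen T)) := (chart T).isIso_app _ (opensRange_chart T).ge
  rw [Scheme.Hom.appLE]
  have h : chart T ⁻¹ᵁ stdOpen T = ⊤ := top_le_iff.1 (top_le_chart_preimage T)
  have : IsIso (homOfLE (top_le_chart_preimage T)) := ⟨homOfLE le_top, rfl, rfl⟩
  infer_instance

/-- Functions on a standard chart are polynomials. -/
def toR (T : Letter → Fin 2) : Γ(Sextuple, stdOpen T) ≃+* R :=
  (asIso ((chart T).appLE (stdOpen T) ⊤ (top_le_chart_preimage T)) ≪≫
    Scheme.ΓSpecIso (.of R)).commRingCatIsoToRingEquiv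

lemma toR_apply (T : Letter → Fin 2) (y : Γ(Sextuple, stdOpen T)) : toR T y =
    (Scheme.ΓSpecIso (.of R)).hom ((chart T).appLE (stdOpen T) ⊤ (top_le_chart_preimage T) y) := rfl

lemma toR_stdCoord (x : Letter) : toR 0 (stdCoord x) = X x := by
  rw [toR_apply, chart_stdCoord]
  simp

lemma sharp_toR {T : Letter → Fin 2} {Z : Scheme.{0}} (g : Z ⟶ Spec (.of R))
    (f : Z ⟶ Sextuple) (h : g ≫ chart T = f) (hf : ⊤ ≤ f ⁻¹ᵁ stdOpen T)
    (y : Γ(Sextuple, stdOpen T)) : sharp g (toR T y) = f.appLE (stdOpen T) ⊤ hf y := by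
  subst h
  rw [toR_apply, sharp, Scheme.Hom.appTop, Scheme.Hom.app_eq_appLE]
  have := Scheme.Hom.appLE_comp_appLE g (chart T) (stdOpen T) ⊤ ⊤ (top_le_chart_preimage T) le_top
  rw [← this]
  simp

lemma sharp_SpecMap {A B : Type} [CommRing A] [CommRing B] (φ : A →+* B) (a : A) :
    sharp (Spec.map (CommRingCat.ofHom φ)) a = (Scheme.ΓSpecIso (.of B)).inv (φ a) := by
  rw [sharp, ← Scheme.ΓSpecIso_inv_naturality]
  rfl

lemma rel_sharp_eq_zero_iff {T : Letter → Fin 2} {Z : Scheme.{0}} (g : Z ⟶ Spec (.of R))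
    (x y : Letter) : sharp g (rel T X x y) = 0 ↔ g ≫ chart T ≫ pr x = g ≫ chart T ≫ pr y := by
  rw [chart_pr_eq_iff g g T T rfl, ← rel_map, rel]
  split_ifs
  · exact sub_eq_zero
  · exact sub_eq_zero

lemma genericPoint_mem_stdOpen (T : Letter → Fin 2) : genericPoint Sextuple ∈ stdOpen T :=
  ((genericPoint_spec Sextuple).mem_open_set_iff (stdOpen T).isOpen).2
    ⟨_, trivial, chart_unitPoint_mem T T⟩

/-- The functions on a standard chart as rational functions. -/
def toFunctionField (T : Letter → Fin 2) : R →+* Sextuple.functionField :=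
  (Sextuple.presheaf.germ (stdOpen T) _ (genericPoint_mem_stdOpen T)).hom.comp
    (toR T).symm.toRingHom

lemma coord_eq (x : Letter) : coord x = toFunctionField 0 (X x) := by
  rw [← toR_stdCoord]
  simp [toFunctionField, coord]

/-- The spectrum of the function field maps into every chart, because the generic point lies in
each; comparing its factorizations through charts `0` and `T` gives the relation. -/
lemma coord_eq_of_chart (T : Letter → Fin 2) (x : Letter) :
    if T x = 0 then coord x = toFunctionField T (X x) else coord x * toFunctionField T (X x) = 1 := by
  let f := Sextuple.fromSpecStalk (genericPoint Sextuple)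
  have hf T : ⊤ ≤ f ⁻¹ᵁ stdOpen T := by
    intro p _
    have : f p ⤳ genericPoint Sextuple := by
      have : f p ∈ Set.range f := ⟨p, rfl⟩
      rwa [Scheme.range_fromSpecStalk] at this
    exact this.mem_open (stdOpen T).isOpen (genericPoint_mem_stdOpen T)
  have hg T : ∃ g : Spec Sextuple.functionField ⟶ Spec (.of R), g ≫ chart T = f := by
    refine ⟨IsOpenImmersion.lift (chart T) f ?_, IsOpenImmersion.lift_fac _ _ _⟩
    rintro _ ⟨p, rfl⟩
    have : f p ∈ (chart T).opensRange := by
      rw [opensRange_chart]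
      exact hf T trivial
    exact this
  choose g hg using hg
  have hs T x : (Scheme.ΓSpecIso Sextuple.functionField).inv (toFunctionField T (X x)) =
      coords (g T) x := by
    have h : f.appLE (stdOpen T) ⊤ (hf T) =
        Sextuple.presheaf.germ (stdOpen T) _ (genericPoint_mem_stdOpen T) ≫
          (Scheme.ΓSpecIso Sextuple.functionField).inv := by
      rw [Scheme.Hom.appLE, Scheme.fromSpecStalk_app (genericPoint_mem_stdOpen T), Category.assoc,
        Category.assoc, ← Functor.map_comp]
      congr 1
    rw [coords, ← (toR T).apply_symm_apply (X x), sharp_toR _ _ (hg T) (hf T), h,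
      (toR T).apply_symm_apply]
    rfl
  have hb T : g T ≫ Spec.map (CommRingCat.ofHom (algebraMap ℂ R)) = f ≫ Sextuple.str := by
    rw [← chart_str T, ← Category.assoc, hg]
  have key := (chart_pr_eq_iff (g 0) (g T) 0 T ((hb 0).trans (hb T).symm) x x).1 (by
    rw [← Category.assoc, hg, ← Category.assoc, hg])
  rw [← hs, ← hs, ← coord_eq] at key
  have hinj : Function.Injective (Scheme.ΓSpecIso Sextuple.functionField).inv :=
    (Scheme.ΓSpecIso Sextuple.functionField).symm.commRingCatIsoToRingEquiv.injective
  rcases Fin.eq_zero_or_one (T x) with h | h <;>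
    simp only [h, Pi.zero_apply, Fin.isValue, zero_ne_one, one_ne_zero, ↓reduceIte] at key ⊢
  · exact hinj key
  · apply hinj
    rw [map_mul, key, map_one]

/-! ### Polydiagonals on the standard charts -/

/-- The tautological point over `R / (rel)` satisfies the equation, hence factors through the
equalizer, so functions vanishing on the equalizer vanish in that quotient. Conversely `rel` itself
vanishes on the part of the equalizer inside the chart. -/
lemma ker_equalizer_ideal (T : Letter → Fin 2) (x y : Letter) :
    (equalizer.ι (pr x) (pr y)).ker.ideal (stdAffine T) =
      (Ideal.span {rel T (X : Letter → R) x y}).map (toR T).symm := by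
  let ι := equalizer.ι (pr x) (pr y)
  have hι : ι ≫ pr x = ι ≫ pr y := equalizer.condition _ _
  rw [Scheme.Hom.ker_apply, Ideal.map_symm]
  ext f
  rw [RingHom.mem_ker, Ideal.mem_comap]
  constructor
  · intro hf
    let φ := Ideal.Quotient.mk (Ideal.span {rel T (X : Letter → R) x y})
    let g := Spec.map (CommRingCat.ofHom φ)
    have h0 : sharp g (rel T X x y) = 0 := by
      rw [sharp_SpecMap, Ideal.Quotient.eq_zero_iff_mem.2 (Ideal.mem_span_singleton_self _), map_zero]
    have hg : (g ≫ chart T) ≫ pr x = (g ≫ chart T) ≫ pr y := by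
      rw [Category.assoc, Category.assoc]
      exact (rel_sharp_eq_zero_iff g x y).1 h0
    let e := equalizer.lift (g ≫ chart T) hg
    have he : e ≫ ι = g ≫ chart T := equalizer.lift_ι _ _
    have hle : ⊤ ≤ (e ≫ ι) ⁻¹ᵁ stdOpen T := by
      rw [he]
      exact fun p _ => top_le_chart_preimage T (x := g p) trivial
    have h1 := sharp_toR g (e ≫ ι) he.symm hle f
    rw [sharp_SpecMap, Scheme.Hom.comp_appLE] at h1
    have h2 : (Scheme.ΓSpecIso (.of _)).inv (φ (toR T f)) = 0 := by
      rw [h1, CommRingCat.comp_apply, hf, map_zero]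
    have hinj := (Scheme.ΓSpecIso (.of (R ⧸ Ideal.span {rel T (X : Letter → R) x y}))).symm.commRingCatIsoToRingEquiv.injective
    have h3 : φ (toR T f) = 0 := hinj (h2.trans (map_zero _).symm)
    exact Ideal.Quotient.eq_zero_iff_mem.1 h3
  · intro hf
    let W := ι ⁻¹ᵁ stdOpen T
    let u := W.ι ≫ ι
    have hu : ⊤ ≤ u ⁻¹ᵁ stdOpen T := fun p _ => p.2
    let g := IsOpenImmersion.lift (chart T) u (by
      rintro _ ⟨p, rfl⟩
      have : u p ∈ (chart T).opensRange := by
        rw [opensRange_chart]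
        exact hu trivial
      exact this)
    have hg : g ≫ chart T = u := IsOpenImmersion.lift_fac _ _ _
    have h0 : sharp g (rel T X x y) = 0 := by
      rw [rel_sharp_eq_zero_iff, ← Category.assoc, hg, ← Category.assoc, hg, Category.assoc,
        Category.assoc, hι]
    obtain ⟨m, hm⟩ := Ideal.mem_span_singleton.1 hf
    have h1 := sharp_toR g u hg hu f
    rw [hm, map_mul, h0, zero_mul, Scheme.Hom.comp_appLE, CommRingCat.comp_apply] at h1
    have : IsIso (W.ι.appLE W ⊤ hu) := inferInstanceAs (IsIso (W.ι.appLE W ⊤ W.ι_preimage_self.ge))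
    exact (asIso (W.ι.appLE W ⊤ hu)).commRingCatIsoToRingEquiv.injective
      (h1.symm.trans (map_zero _).symm)

lemma mem_block_iff (i : Fin 6) (x y : Letter) :
    (∃ b ∈ (vartheta i).parts, x ∈ b ∧ y ∈ b) ↔ blockRep i x = blockRep i y := by
  change (∃ b ∈ blocks i, x ∈ b ∧ y ∈ b) ↔ _
  revert i x y
  decide

lemma ideal_iSup_prop {Y : Scheme.{0}} (p : Prop) (I : Y.IdealSheafData) (U : Y.affineOpens) :
    (⨆ _ : p, I).ideal U = ⨆ _ : p, I.ideal U := by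
  by_cases h : p <;> simp [h, Scheme.IdealSheafData.ideal_bot]

lemma polydiagonal_ideal (T : Letter → Fin 2) (i : Fin 6) :
    (polydiagonal (vartheta i)).ideal (stdAffine T) =
      (chartIdeal T (X : Letter → R) (blockRep i)).map (toR T).symm := by
  simp only [polydiagonal, Scheme.IdealSheafData.ideal_iSup, iSup_apply, ideal_iSup_prop,
    ker_equalizer_ideal, mem_block_iff, ← Ideal.map_iSup]
  congr 1
  apply le_antisymm
  · refine iSup_le fun x => iSup_le fun y => iSup_le fun h => ?_
    rw [Ideal.span_singleton_le_iff_mem]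
    exact rel_mem_chartIdeal T X _ h
  · rw [chartIdeal, Ideal.span_le]
    rintro _ ⟨x, rfl⟩
    refine Ideal.mem_iSup_of_mem x (Ideal.mem_iSup_of_mem (blockRep i x)
      (Ideal.mem_iSup_of_mem (blockRep_idem i x).symm (Ideal.mem_span_singleton_self _)))

/-! ### The indeterminacy scheme -/

lemma chart_mem_basicOpen_iff (T : Letter → Fin 2) (z : Spec (.of R)) (y : Γ(Sextuple, stdOpen T)) :
    chart T z ∈ Sextuple.basicOpen y ↔ toR T y ∉ z.asIdeal := by
  have h1 : chart T z ∈ Sextuple.basicOpen y ↔ z ∈ chart T ⁻¹ᵁ Sextuple.basicOpen y := Iff.rfl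
  have h2 : z ∈ (Spec (.of R)).basicOpen ((chart T).app (stdOpen T) y) ↔
      z ∈ (Spec (.of R)).basicOpen
        ((chart T).appLE (stdOpen T) ⊤ (top_le_chart_preimage T) y) := by
    rw [Scheme.Hom.appLE, CommRingCat.comp_apply, Scheme.basicOpen_res]
    simp
  rw [h1, Scheme.preimage_basicOpen, h2, basicOpen_eq_of_affine']
  rfl

/-- The homomorphism from the coordinate ring of a standard chart to the local ring at a point. -/
def stalkHom (T : Letter → Fin 2) (p : Sextuple) (hp : p ∈ stdOpen T) :
    R →+* Sextuple.presheaf.stalk p :=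
  (Sextuple.presheaf.germ (stdOpen T) p hp).hom.comp (toR T).symm.toRingHom

lemma stalkHom_toR (T : Letter → Fin 2) (p : Sextuple) (hp : p ∈ stdOpen T)
    (y : Γ(Sextuple, stdOpen T)) :
    stalkHom T p hp (toR T y) = Sextuple.presheaf.germ (stdOpen T) p hp y := by
  simp [stalkHom]

lemma isLocalization_stalkHom (T : Letter → Fin 2) (p : Sextuple) (hp : p ∈ stdOpen T) :
    ∃ (P : Ideal R) (_ : P.IsPrime), letI := (stalkHom T p hp).toAlgebra
      IsLocalization.AtPrime (Sextuple.presheaf.stalk p) P := by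
  have h := (isAffineOpen_stdOpen T).isLocalization_stalk ⟨p, hp⟩
  let Q := ((isAffineOpen_stdOpen T).primeIdealOf ⟨p, hp⟩).asIdeal
  have hQ : (Q.comap (toR T).symm).primeCompl = Q.primeCompl.map (toR T : _ →* R) := by
    ext r
    simp only [Submonoid.mem_map, Ideal.mem_primeCompl_iff, Ideal.mem_comap]
    constructor
    · exact fun hr => ⟨_, hr, (toR T).apply_symm_apply r⟩
    · rintro ⟨y, hy, rfl⟩
      simpa using hy
  refine ⟨Q.comap (toR T).symm, inferInstance, ?_⟩
  rw [IsLocalization.AtPrime, hQ]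
  let := TopCat.Presheaf.algebra_section_stalk Sextuple.presheaf (U := stdOpen T) ⟨p, hp⟩
  have : IsLocalization Q.primeCompl (Sextuple.presheaf.stalk p) := h
  exact IsLocalization.isLocalization_of_base_ringEquiv Q.primeCompl (Sextuple.presheaf.stalk p)
    (toR T)

lemma toFunctionField_eq (T : Letter → Fin 2) (p : Sextuple) (hp : p ∈ stdOpen T) (r : R) :
    toFunctionField T r = algebraMap (Sextuple.presheaf.stalk p) Sextuple.functionField
      (stalkHom T p hp r) := by
  have : Nonempty (stdOpen T) := ⟨⟨p, hp⟩⟩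
  rw [← (toR T).apply_symm_apply r, stalkHom_toR]
  rw [Scheme.algebraMap_germ_eq_germToFunctionField]
  simp [toFunctionField]

theorem baseIdealAt_pascalMap (T : Letter → Fin 2) (p : Sextuple) (hp : p ∈ stdOpen T) :
    baseIdealAt pascalMap p =
      ⨅ i, (chartIdeal T (X : Letter → R) (blockRep i)).map (stalkHom T p hp) := by
  obtain ⟨P, hP, hloc⟩ := isLocalization_stalkHom T p hp
  let := (stalkHom T p hp).toAlgebra
  rw [pascalMap_eq]
  refine traceIdeal_span_pascalForms T P (Sextuple.presheaf.stalk p) Sextuple.functionField coord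
    fun x => ?_
  have h := coord_eq_of_chart T x
  rwa [toFunctionField_eq T p hp] at h

/-- Extending the prime to the stalk at its own point and contracting gives it back: functions
outside `P` are units in the stalk, so they do not vanish at that point. -/
lemma mem_of_stalkHom_mem (T : Letter → Fin 2) (z : Spec (.of R)) (hp : chart T z ∈ stdOpen T)
    {r : R} (hr : stalkHom T _ hp r ∈ z.asIdeal.map (stalkHom T _ hp)) : r ∈ z.asIdeal := by
  obtain ⟨P, hP, hloc⟩ := isLocalization_stalkHom T _ hp
  let := (stalkHom T _ hp).toAlgebra
  have hle : z.asIdeal ≤ P := by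
    intro a ha
    by_contra haP
    have hu : IsUnit (stalkHom T _ hp a) := IsLocalization.map_units _ (⟨a, haP⟩ : P.primeCompl)
    rw [← (toR T).apply_symm_apply a, stalkHom_toR, ← Scheme.mem_basicOpen,
      chart_mem_basicOpen_iff, RingEquiv.apply_symm_apply] at hu
    exact hu ha
  obtain ⟨u, hu, hur⟩ := (IsLocalization.algebraMap_mem_map_algebraMap_iff P.primeCompl
    (Sextuple.presheaf.stalk (chart T z)) z.asIdeal r).1 hr
  exact (z.isPrime.mem_or_mem hur).resolve_left fun h => hu (hle h)

/-- The ideal sheaf of the union of the six polydiagonals. -/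
abbrev unionIdeal : Sextuple.IdealSheafData := ⨅ i, polydiagonal (vartheta i)

lemma unionIdeal_ideal (T : Letter → Fin 2) : unionIdeal.ideal (stdAffine T) =
    ⨅ i, (chartIdeal T (X : Letter → R) (blockRep i)).map (toR T).symm := by
  rw [unionIdeal, Scheme.IdealSheafData.ideal_iInf, iInf_apply]
  simp only [polydiagonal_ideal]

/-- Near `p` the two affine opens share a basic open set, over which both ideals restrict to the
same one. -/
lemma germ_mem_map_of_mem {Y : Scheme.{0}} (J : Y.IdealSheafData) (U V : Y.affineOpens) (p : Y)
    (hU : p ∈ U.1) (hV : p ∈ V.1) {f : Γ(Y, U.1)} (hf : f ∈ J.ideal U) :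
    Y.presheaf.germ U.1 p hU f ∈ (J.ideal V).map (Y.presheaf.germ V.1 p hV).hom := by
  obtain ⟨g, h, hgh, hp⟩ := exists_basicOpen_le_affine_inter U.2 V.2 p ⟨hU, hV⟩
  let W : Y.affineOpens := ⟨Y.basicOpen g, U.2.basicOpen g⟩
  have hWU : W ≤ U := Y.basicOpen_le g
  have hWV : W ≤ V := hgh.le.trans (Y.basicOpen_le h)
  have h1 : Y.presheaf.map (homOfLE hWU).op f ∈ J.ideal W := J.ideal_le_comap_ideal hWU hf
  have h2 := Ideal.mem_map_of_mem (Y.presheaf.germ W.1 p hp).hom h1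
  have h3 : (Y.presheaf.germ W.1 p hp).hom.comp (Y.presheaf.map (homOfLE hWV).op).hom =
      (Y.presheaf.germ V.1 p hV).hom :=
    congrArg CommRingCat.Hom.hom (Y.presheaf.germ_res (homOfLE hWV) p hp)
  rw [← J.map_ideal hWV, Ideal.map_map, h3] at h2
  convert h2 using 1
  exact (Y.presheaf.germ_res_apply (homOfLE hWU) p hp f).symm

/-- For the first inclusion the germ condition is needed only at the six generic points, one per
polydiagonal, since each chart ideal is prime. The other is checked at every point, in any standard
chart containing it. -/
theorem indeterminacy_eq : indeterminacy pascalMap = unionIdeal := by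
  apply le_antisymm
  · refine Scheme.IdealSheafData.le_of_iSup_eq_top stdAffine iSup_stdAffine fun T f hf => ?_
    have hf' := Scheme.IdealSheafData.ideal_ofIdeals_le _ _ hf
    rw [unionIdeal_ideal, Ideal.mem_iInf]
    intro i
    have := chartIdeal_isPrime T (blockRep_idem i)
    let z : Spec (.of R) := ⟨chartIdeal T (X : Letter → R) (blockRep i), this⟩
    have hz : chart T z ∈ stdOpen T := top_le_chart_preimage T (x := z) trivial
    have h1 := (Ideal.mem_iInf.1 hf') ⟨chart T z, hz⟩
    rw [Ideal.mem_comap, baseIdealAt_pascalMap T _ hz, Ideal.mem_iInf] at h1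
    have h2 := h1 i
    rw [Ideal.map_symm, Ideal.mem_comap]
    refine mem_of_stalkHom_mem T z hz ?_
    rw [stalkHom_toR]
    exact h2
  · rw [indeterminacy, Scheme.IdealSheafData.le_ofIdeals_iff]
    intro U f hf
    rw [Ideal.mem_iInf]
    rintro ⟨p, hp⟩
    obtain ⟨T, hT⟩ := exists_mem_stdOpen p
    rw [Ideal.mem_comap, baseIdealAt_pascalMap T p hT, Ideal.mem_iInf]
    intro i
    have h1 := germ_mem_map_of_mem unionIdeal U (stdAffine T) p hp hT hf
    rw [unionIdeal_ideal] at h1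
    have h2 := Ideal.map_mono (iInf_le _ i) h1
    exact (Ideal.map_map (I := chartIdeal T (X : Letter → R) (blockRep i)) (toR T).symm.toRingHom
      (Sextuple.presheaf.germ (stdOpen T) p hT).hom).le h2

/-! ### The indeterminacy scheme on the affine chart -/

lemma transversal_X : Transversal (X : Letter → R) := by
  intro r hr x y hxy h hh
  have := chartIdeal_isPrime 0 hr
  exact (Ideal.IsPrime.mem_or_mem this hh).resolve_left (rel_notMem_chartIdeal 0 hr hxy)

lemma pascalIdeal_eq : pascalIdeal = ⨅ i, linearIdeal i := by
  simp only [linearIdeal_eq]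
  exact (iInf_diagIdeal transversal_X).symm

lemma mem_comap_ideal_iff {Y Z : Scheme.{0}} (I : Z.IdealSheafData) (f : Y ⟶ Z) [IsOpenImmersion f]
    (U : Y.affineOpens) (V : Z.affineOpens) (e : U.1 ≤ f ⁻¹ᵁ V.1) (h : f ''ᵁ U.1 = V.1)
    (w : Γ(Z, V.1)) : f.appLE V.1 U.1 e w ∈ (I.comap f).ideal U ↔ w ∈ I.ideal V := by
  obtain ⟨V, hV⟩ := V
  dsimp only at h
  subst h
  rw [Scheme.IdealSheafData.ideal_comap_of_isOpenImmersion, Ideal.mem_comap]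
  have h1 : f.appLE (f ''ᵁ U.1) U.1 e ≫ (f.appIso U.1).inv = 𝟙 _ :=
    (Scheme.Hom.appLE_appIso_inv f e).trans (Z.presheaf.map_id _)
  have h2 : (f.appIso U.1).inv (f.appLE (f ''ᵁ U.1) U.1 e w) = w :=
    (CommRingCat.comp_apply _ _ _).symm.trans (by rw [h1]; rfl)
  exact h2.symm ▸ Iff.rfl

lemma appTop_SpecMap_eq_zero_iff {A B : Type} [CommRing A] [CommRing B] (φ : A →+* B)
    (y : Γ(Spec (.of A), ⊤)) : (Spec.map (CommRingCat.ofHom φ)).appTop y = 0 ↔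
      φ ((Scheme.ΓSpecIso (.of A)).hom y) = 0 := by
  have h : (Scheme.ΓSpecIso (.of B)).hom ((Spec.map (CommRingCat.ofHom φ)).appTop y) =
      φ ((Scheme.ΓSpecIso (.of A)).hom y) :=
    ConcreteCategory.congr_hom (Scheme.ΓSpecIso_naturality (CommRingCat.ofHom φ)) y
  rw [← h]
  exact (map_eq_zero_iff (Scheme.ΓSpecIso (.of B)).commRingCatIsoToRingEquiv
    (RingEquiv.injective _)).symm

lemma comap_chart_indeterminacy : (indeterminacy pascalMap).comap (chart 0) =
    (Spec.map (CommRingCat.ofHom (Ideal.Quotient.mk pascalIdeal))).ker := by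
  apply Scheme.IdealSheafData.ext_of_isAffine
  rw [Scheme.Hom.ker_apply, indeterminacy_eq]
  ext y
  obtain ⟨w, rfl⟩ : ∃ w, (chart 0).appLE (stdOpen 0) ⊤ (top_le_chart_preimage 0) w = y := by
    obtain ⟨w, hw⟩ := (toR 0).surjective ((Scheme.ΓSpecIso (.of R)).hom y)
    refine ⟨w, ?_⟩
    rw [toR_apply] at hw
    exact (Scheme.ΓSpecIso (.of R)).commRingCatIsoToRingEquiv.injective hw
  have h1 := mem_comap_ideal_iff unionIdeal (chart 0) ⟨⊤, isAffineOpen_top _⟩ (stdAffine 0)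
    (top_le_chart_preimage 0) ((chart 0).image_top_eq_opensRange.trans (opensRange_chart 0)) w
  refine h1.trans ?_
  have h2 := appTop_SpecMap_eq_zero_iff (Ideal.Quotient.mk pascalIdeal)
    ((chart 0).appLE (stdOpen 0) ⊤ (top_le_chart_preimage 0) w)
  rw [← toR_apply, Ideal.Quotient.eq_zero_iff_mem] at h2
  refine Iff.trans ?_ h2.symm
  rw [unionIdeal_ideal, pascalIdeal_eq]
  simp only [Ideal.map_symm, linearIdeal_eq, chartIdeal_const, Ideal.mem_iInf, Ideal.mem_comap]

/-! ### Supports of the polydiagonals -/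

lemma chart_mem_support_iff (I : Sextuple.IdealSheafData) (T : Letter → Fin 2) (q : Ideal R)
    (h : I.ideal (stdAffine T) = q.map (toR T).symm) (z : Spec (.of R)) :
    chart T z ∈ I.support ↔ q ≤ z.asIdeal := by
  have hz : chart T z ∈ (stdAffine T).1 := top_le_chart_preimage T (x := z) trivial
  rw [Scheme.IdealSheafData.mem_support_iff_of_mem hz, Scheme.mem_zeroLocus_iff, h]
  simp only [chart_mem_basicOpen_iff, not_not]
  constructor
  · intro H r hr
    have := H _ (Ideal.mem_map_of_mem (toR T).symm hr)
    rwa [RingEquiv.apply_symm_apply] at this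
  · intro H f hf
    rw [SetLike.mem_coe, Ideal.map_symm, Ideal.mem_comap] at hf
    exact H hf

lemma chart_mem_support_polydiagonal_iff (T : Letter → Fin 2) (i : Fin 6) (z : Spec (.of R)) :
    chart T z ∈ (polydiagonal (vartheta i)).support ↔
      chartIdeal T (X : Letter → R) (blockRep i) ≤ z.asIdeal :=
  chart_mem_support_iff _ _ _ (polydiagonal_ideal T i) z

lemma support_inter_stdOpen (T : Letter → Fin 2) (i : Fin 6) :
    ((polydiagonal (vartheta i)).support : Set Sextuple) ∩ stdOpen T =
      chart T '' PrimeSpectrum.zeroLocus (chartIdeal T (X : Letter → R) (blockRep i)) := by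
  ext p
  constructor
  · rintro ⟨h, hp⟩
    rw [SetLike.mem_coe, ← opensRange_chart] at hp
    obtain ⟨z, rfl⟩ := hp
    exact ⟨z, (chart_mem_support_polydiagonal_iff T i z).1 h, rfl⟩
  · rintro ⟨z, hz, rfl⟩
    exact ⟨(chart_mem_support_polydiagonal_iff T i z).2 hz, top_le_chart_preimage T (x := z) trivial⟩

/-- When all six points equal `1`, every partition condition holds, and `1` has the same coordinate
in both charts of `P1`. -/
lemma chart_unitPoint_mem_support (T : Letter → Fin 2) (i : Fin 6) :
    chart T unitPoint ∈ (polydiagonal (vartheta i)).support := by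
  rw [chart_mem_support_polydiagonal_iff]
  let φ : R →+* ℂ := (aeval (fun _ => (1 : ℂ)) : R →ₐ[ℂ] ℂ).toRingHom
  have h : unitPoint.asIdeal = RingHom.ker φ := rfl
  rw [h]
  refine chartIdeal_le_ker φ T X _ fun x => ?_
  unfold rel
  split_ifs <;> simp [φ]

/-- On each chart the polydiagonal is the zero locus of a prime. Each of these pieces meets `stdOpen
0`, at the point with all coordinates `1`, so the piece in chart `0` is dense. -/
lemma isIrreducible_support (i : Fin 6) :
    IsIrreducible ((polydiagonal (vartheta i)).support : Set Sextuple) := by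
  let S : Set Sextuple := (polydiagonal (vartheta i)).support
  have hS : IsClosed S := (polydiagonal (vartheta i)).support.isClosed
  have hT T : IsIrreducible (S ∩ stdOpen T) := by
    have hprime := chartIdeal_isPrime T (blockRep_idem i)
    have := ((PrimeSpectrum.isIrreducible_zeroLocus_iff_of_radical _ hprime.isRadical).2
      hprime).image (chart T) (chart T).continuous.continuousOn
    exact (support_inter_stdOpen T i).symm ▸ this
  have hcl : closure (S ∩ stdOpen 0) = S := by
    refine (closure_minimal Set.inter_subset_left hS).antisymm fun p hp => ?_
    obtain ⟨T, hpT⟩ := exists_mem_stdOpen p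
    refine closure_mono ?_ (subset_closure_inter_of_isPreirreducible_of_isOpen (hT T).2
      (stdOpen 0).isOpen ⟨chart T unitPoint, ⟨chart_unitPoint_mem_support T i,
        chart_unitPoint_mem T T⟩, chart_unitPoint_mem T 0⟩ ⟨hp, hpT⟩)
    exact Set.inter_subset_inter_left _ Set.inter_subset_left
  have := (hT 0).closure
  rwa [hcl] at this

/-- The generic point of the first polydiagonal, seen in chart `0`, turns inclusion of supports into
the reverse inclusion of primes. -/
lemma eq_of_support_subset (i j : Fin 6) (h : ((polydiagonal (vartheta i)).support : Set Sextuple) ⊆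
    (polydiagonal (vartheta j)).support) : i = j := by
  have := chartIdeal_isPrime 0 (blockRep_idem i)
  let z : Spec (.of R) := ⟨chartIdeal 0 (X : Letter → R) (blockRep i), this⟩
  have h1 : chart 0 z ∈ (polydiagonal (vartheta i)).support :=
    (chart_mem_support_polydiagonal_iff 0 i z).2 le_rfl
  exact (chartIdeal_zero_le_iff j i ((chart_mem_support_polydiagonal_iff 0 j z).1 (h h1))).symm

/-- A prime contains a finite intersection of ideals exactly when it contains one of them. -/
lemma support_unionIdeal :
    (unionIdeal.support : Set Sextuple) = ⋃ i, ((polydiagonal (vartheta i)).support : Set Sextuple) := by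
  ext p
  obtain ⟨T, hT⟩ := exists_mem_stdOpen p
  rw [← opensRange_chart] at hT
  obtain ⟨z, rfl⟩ := hT
  rw [Set.mem_iUnion, SetLike.mem_coe]
  simp only [SetLike.mem_coe, chart_mem_support_polydiagonal_iff]
  rw [chart_mem_support_iff unionIdeal T (⨅ i, chartIdeal T (X : Letter → R) (blockRep i))]
  · have := Ideal.IsPrime.inf_le' (s := Finset.univ)
      (f := fun i => chartIdeal T (X : Letter → R) (blockRep i)) z.isPrime
    rw [Finset.inf_univ_eq_iInf] at this
    simpa using this
  · rw [unionIdeal_ideal]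
    simp only [Ideal.map_symm, Ideal.comap_iInf]

/-! ### Reducedness and irreducible components -/

lemma isReduced_subscheme (I : Sextuple.IdealSheafData)
    (h : ∀ T, (I.ideal (stdAffine T)).IsRadical) : IsReduced I.subscheme := by
  have hI : I.radical = I :=
    Scheme.IdealSheafData.ext_of_iSup_eq_top stdAffine iSup_stdAffine fun T => (h T).radical
  have hr (U : Sextuple.affineOpens) : (I.ideal U).IsRadical := by
    have := congrArg (fun J => J.ideal U) hI
    exact Ideal.radical_eq_iff.1 this
  have hcov (U : Sextuple.affineOpens) :
      AlgebraicGeometry.IsReduced (Spec (.of (Γ(Sextuple, U.1) ⧸ I.ideal U))) := by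
    have : _root_.IsReduced (Γ(Sextuple, U.1) ⧸ I.ideal U) :=
      (Ideal.isRadical_iff_quotient_reduced _).1 (hr U)
    infer_instance
  have : ∀ U, AlgebraicGeometry.IsReduced (I.subschemeCover.openCover.X U) := hcov
  exact IsReduced.of_openCover I.subscheme I.subschemeCover.openCover

lemma isIrreducible_preimage_of_isInducing {Y Z : Type*} [TopologicalSpace Y] [TopologicalSpace Z]
    {f : Y → Z} (hf : Topology.IsInducing f) {S : Set Z} (hS : IsIrreducible S)
    (hr : S ⊆ Set.range f) : IsIrreducible (f ⁻¹' S) := by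
  constructor
  · obtain ⟨s, hs⟩ := hS.1
    obtain ⟨y, rfl⟩ := hr hs
    exact ⟨y, hs⟩
  · rintro u v hu hv ⟨a, ha, hau⟩ ⟨b, hb, hbv⟩
    obtain ⟨u', hu', rfl⟩ := hf.isOpen_iff.1 hu
    obtain ⟨v', hv', rfl⟩ := hf.isOpen_iff.1 hv
    obtain ⟨s, hs, hsu⟩ := hS.2 u' v' hu' hv' ⟨_, ha, hau⟩ ⟨_, hb, hbv⟩
    obtain ⟨y, rfl⟩ := hr hs
    exact ⟨y, hs, hsu⟩

/-- An irreducible set covered by finitely many closed sets lies in one of them; the absence of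
inclusions then makes every `Z i` maximal. -/
lemma irreducibleComponents_eq_range {Y ι : Type*} [TopologicalSpace Y] [Finite ι] {Z : ι → Set Y}
    (hc : ∀ i, IsClosed (Z i)) (hi : ∀ i, IsIrreducible (Z i)) (hU : ⋃ i, Z i = Set.univ)
    (hZ : ∀ i j, Z i ⊆ Z j → i = j) : irreducibleComponents Y = Set.range Z := by
  have key {s : Set Y} (hs : IsIrreducible s) : ∃ j, s ⊆ Z j := by
    obtain ⟨t, ht, hst⟩ := isIrreducible_iff_sUnion_isClosed.1 hs (Set.finite_range Z).toFinset
      (by simpa using hc) (by simp [Set.sUnion_range, hU])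
    obtain ⟨j, rfl⟩ := (Set.finite_range Z).mem_toFinset.1 ht
    exact ⟨j, hst⟩
  ext s
  constructor
  · intro hs
    obtain ⟨j, hj⟩ := key hs.1
    exact ⟨j, (hs.2 (hi j) hj).antisymm hj⟩
  · rintro ⟨i, rfl⟩
    refine ⟨hi i, fun t ht hit => ?_⟩
    obtain ⟨j, hj⟩ := key ht
    obtain rfl := hZ i j (hit.trans hj)
    exact hj

lemma isIntegral_polydiagonal (i : Fin 6) : IsIntegral (polydiagonal (vartheta i)).subscheme := by
  let I := polydiagonal (vartheta i)
  have hred : IsReduced I.subscheme := by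
    refine isReduced_subscheme I fun T => ?_
    have := chartIdeal_isPrime T (blockRep_idem i)
    rw [polydiagonal_ideal, Ideal.map_symm]
    exact (Ideal.comap_isPrime (toR T) _).isRadical
  have hirr : IrreducibleSpace I.subscheme := by
    rw [irreducibleSpace_def]
    have := isIrreducible_preimage_of_isInducing I.subschemeι.isEmbedding.isInducing
      (isIrreducible_support i) I.range_subschemeι.ge
    rwa [← I.range_subschemeι, Set.preimage_range] at this
  exact isIntegral_of_irreducibleSpace_of_isReduced _

lemma isReduced_union : IsReduced unionIdeal.subscheme := by
  refine isReduced_subscheme _ fun T => ?_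
  rw [unionIdeal_ideal]
  refine Ideal.isRadical_iInf _ fun i => ?_
  have := chartIdeal_isPrime T (blockRep_idem i)
  rw [Ideal.map_symm]
  exact (Ideal.comap_isPrime (toR T) _).isRadical

lemma eq_of_preimage_support_subset (i j : Fin 6)
    (h : unionIdeal.subschemeι ⁻¹' ((polydiagonal (vartheta i)).support : Set Sextuple) ⊆
      unionIdeal.subschemeι ⁻¹' ((polydiagonal (vartheta j)).support : Set Sextuple)) : i = j := by
  apply eq_of_support_subset
  refine (Set.preimage_subset_preimage_iff ?_).1 h
  rw [unionIdeal.range_subschemeι, support_unionIdeal]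
  exact Set.subset_iUnion (fun i => ((polydiagonal (vartheta i)).support : Set Sextuple)) i

lemma irreducibleComponents_union : irreducibleComponents unionIdeal.subscheme =
    Set.range fun i => unionIdeal.subschemeι ⁻¹'
      ((polydiagonal (vartheta i)).support : Set Sextuple) := by
  have hr : Set.range unionIdeal.subschemeι = _ := unionIdeal.range_subschemeι
  refine irreducibleComponents_eq_range (fun i => ?_) (fun i => ?_) ?_ eq_of_preimage_support_subset
  · exact (polydiagonal (vartheta i)).support.isClosed.preimage unionIdeal.subschemeι.continuous
  · refine isIrreducible_preimage_of_isInducing unionIdeal.subschemeι.isEmbedding.isInducing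
      (isIrreducible_support i) ?_
    rw [hr, support_unionIdeal]
    exact Set.subset_iUnion (fun i => ((polydiagonal (vartheta i)).support : Set Sextuple)) i
  · rw [← Set.preimage_iUnion, ← support_unionIdeal, ← hr, Set.preimage_range]

set_option maxRecDepth 20000 in
lemma partitionType_vartheta (i : Fin 6) : partitionType (vartheta i) =
    ![{3, 1, 1, 1}, {3, 1, 1, 1}, {2, 2, 1, 1}, {2, 2, 1, 1}, {2, 2, 1, 1}, {2, 2, 2}] i := by
  change (blocks i).val.map Finset.card = _
  revert i
  decide

end

end Pascal


theorem mainTheorem1 :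
    -- the rational map is given by the triple `⟨u₀, u₁, u₂⟩`
    (∃ hu : Pascal.pascalForms Pascal.coord ≠ 0,
      Pascal.pascalMap = Projectivization.mk _ (Pascal.pascalForms Pascal.coord) hu) ∧
    -- `(u₀, u₁, u₂)` is the irredundant intersection of the six linear prime ideals
    (∀ i, (Pascal.linearIdeal i).IsPrime) ∧
    (∀ i j, Pascal.linearIdeal i ≤ Pascal.linearIdeal j → i = j) ∧
    Pascal.pascalIdeal = ⨅ i, Pascal.linearIdeal i ∧
    -- on the affine chart `Spec ℂ[a, …, f]` the indeterminacy scheme is defined by this ideal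
    (Pascal.indeterminacy Pascal.pascalMap).comap (Pascal.chart 0) =
      (Spec.map (CommRingCat.ofHom (Ideal.Quotient.mk Pascal.pascalIdeal))).ker ∧
    -- the indeterminacy scheme is the scheme-theoretic union of the six polydiagonals
    Pascal.indeterminacy Pascal.pascalMap = ⨅ i, Pascal.polydiagonal (Pascal.vartheta i) ∧
    -- the types of the six partitions
    (∀ i, Pascal.partitionType (Pascal.vartheta i) =
      ![{3, 1, 1, 1}, {3, 1, 1, 1}, {2, 2, 1, 1}, {2, 2, 1, 1}, {2, 2, 1, 1}, {2, 2, 2}] i) ∧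
    -- the indeterminacy scheme is reduced, and its irreducible components are the six polydiagonals
    (∀ i, AlgebraicGeometry.IsIntegral (Pascal.polydiagonal (Pascal.vartheta i)).subscheme) ∧
    AlgebraicGeometry.IsReduced (Pascal.indeterminacy Pascal.pascalMap).subscheme ∧
    irreducibleComponents (Pascal.indeterminacy Pascal.pascalMap).subscheme =
      Set.range (fun i => (Pascal.indeterminacy Pascal.pascalMap).subschemeι ⁻¹'
        ((Pascal.polydiagonal (Pascal.vartheta i)).support : Set Pascal.Sextuple)) ∧
    (irreducibleComponents (Pascal.indeterminacy Pascal.pascalMap).subscheme).ncard = 6 := by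
  refine ⟨⟨_, Pascal.pascalMap_eq⟩, fun i => ?_, fun i j h => ?_, Pascal.pascalIdeal_eq,
    Pascal.comap_chart_indeterminacy, Pascal.indeterminacy_eq, Pascal.partitionType_vartheta,
    Pascal.isIntegral_polydiagonal, ?_⟩
  · rw [Pascal.linearIdeal_eq, ← Pascal.chartIdeal_const]
    exact Pascal.chartIdeal_isPrime 0 (Pascal.blockRep_idem i)
  · rw [Pascal.linearIdeal_eq, Pascal.linearIdeal_eq] at h
    exact Pascal.chartIdeal_zero_le_iff i j h
  · rw [Pascal.indeterminacy_eq]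
    refine ⟨Pascal.isReduced_union, Pascal.irreducibleComponents_union, ?_⟩
    rw [Pascal.irreducibleComponents_union, ← Set.image_univ, Set.ncard_image_of_injective,
      Set.ncard_univ, Nat.card_eq_fintype_card, Fintype.card_fin]
    exact fun i j h => Pascal.eq_of_preimage_support_subset i j h.le
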